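/- **Setting.** There are finitely many scenarios $s\in S$ with probabilities $p_s\ge 0$, $\sum_s p_s=1$. The benchmark vector $Z$ takes the values $z_t\in\mathbb R^d$ with probabilities $\tilde p_t\ge 0$, $t\in T$, $T$ finite, $\sum_t\tilde p_t=1$. The set $C$ of scalarization vectors is a non-empty polyhedron contained in the unit simplex of $\mathbb R^d$. The first-stage set $X$ is non-empty and consists of the non-negative points of a convex set $K$ whose prescribed coordinates are integers; the function $f$ is convex on $K$. The second-stage set is $Y_s(x)=\{y\ge 0: T_sx+W_sy\ge h_s\}$ with cost $q_s^\top y$, and for all $x\in X$ and $s\in S$ this cost is bounded below on $Y_s(x)$. The outcomes are $\hat g_s(x,y)=\bar g_sx+\tilde g_sy\in\mathbb R^d$, smaller being better. Write $[a]_+=\max(a,0)$ and $E_t(c)=\sum_{i\in T}\tilde p_i[c^\top z_i-c^\top z_t]_+$. Let $\hat C$ be the set of projections to $c$ of the vertices of the polyhedra $P_t=\{(c,w): c\in C,\ w\in\mathbb R^{T}_+,\ w_i\ge c^\top z_i-c^\top z_t\ \forall i\in T\}$, $t\in T$. The deterministic equivalent of the program with a multivariate increasing convex order (ICO, i.e.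 SSD-type) constraint is $$\text{(DEF)}\quad \min\ f(x)+\sum_s p_s q_s^\top y_s\quad\text{s.t. } x\in X,\ y_s\in Y_s(x),\ \ \sum_s p_s w_{sct}\le E_t(c),\ \ w_{sct}\ge c^\top\hat g_s(x,y_s)-c^\top z_t,\ \ w_{sct}\ge 0\quad (s\in S,\ t\in T,\ c\in\hat C).$$ **Algorithm with tolerance $\varepsilon\ge 0$.** Start with finitely many vectors $\tilde c_1,\dots,\tilde c_L\in C$ (possibly $L=0$), upper bound $u=\infty$, no incumbent, an empty set $\mathcal F$ of feasibility cuts, and a set $\mathcal O$ of optimality cuts that consists of one affine bound $\theta_s\ge a_s^\top x+b_s$ for each $s$, valid in the sense that $a_s^\top x+b_s\le q_s^\top y$ for all $x\in X$, $y\in Y_s(x)$. Repeat: 1. Solve the master problem: $\min f(x)+\sum_s p_s\theta_s$ subject to $x\in X$, the cuts in $\mathcal O$ and $\mathcal F$, $\sum_s p_sw_{slt}\le E_t(\tilde c_l)$ and $w_{slt}\ge 0$ for all $s$, $t$ and $l\le L$. If it is infeasible, stop and report infeasibility. Otherwise let $(\bar x,\bar w,\bar\theta)$ be an optimal solution and $F$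 its value. If $u<\infty$ and $u-\varepsilon|u|\le F\le u+\varepsilon|u|$, stop and return the incumbent. 2. For each $s$ solve the subproblem $$\bar Q_s=\min\{q_s^\top y:\ y\ge 0,\ W_sy\ge h_s-T_s\bar x,\ -\tilde c_l^\top\tilde g_sy\ge\tilde c_l^\top\bar g_s\bar x-\tilde c_l^\top z_t-\bar w_{slt}\ \ \forall t,\ l\le L\}.$$ For multipliers $\gamma$, $\beta$ of its two groups of constraints, put $D_s(\gamma,\beta;x,w)=\gamma^\top(h_s-T_sx)+\sum_{t,l}\beta_{tl}(\tilde c_l^\top\bar g_sx-\tilde c_l^\top z_t-w_{slt})$. If the subproblem is infeasible, take an extreme ray $(\gamma,\beta)$ of the recession cone of the dual feasible set with $D_s(\gamma,\beta;\bar x,\bar w)>0$ and add the cut $0\ge D_s(\gamma,\beta;x,w)$ to $\mathcal F$. If it is feasible, take an optimal solution $\bar y_s$ and an optimal extreme point $(\gamma,\beta)$ of the dual, and if $\bar\theta_s<\bar Q_s$ add the cut $\theta_s\ge D_s(\gamma,\beta;x,w)$ to $\mathcal O$. 3. If all subproblems are feasible, compute for each $t\in T$ an optimal solution $c^*_t$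 of the separation problem $$\min_{c\in C}\ E_t(c)-\sum_s p_s[c^\top\hat g_s(\bar x,\bar y_s)-c^\top z_t]_+$$ that is the projection of a vertex of $P_t$. If all the optimal values are non-negative, make $(\bar x,\bar y)$ the incumbent and set $u=f(\bar x)+\sum_sp_s\bar Q_s$. Otherwise choose some $t$ with a negative optimal value, put $\tilde c_{L+1}=c^*_t$ and increase $L$ by one. **Proposition.** * $\hat C$ is finite, so (DEF) has finitely many constraints of ICO type. * For $\varepsilon=0$, whatever choices are made, every run of the algorithm stops after finitely many iterations. Either it reports infeasibility and (DEF) is infeasible, or it returns $(x,y)$ which, together with $w_{sct}=[c^\top\hat g_s(x,y_s)-c^\top z_t]_+$, is an optimal solution of (DEF). Moreover each such run is, with the same choices and the same result, a run of the algorithm for every sufficiently small $\varepsilon>0$ (how small may depend on the run). * For every $\varepsilon\ge 0$, every run stops after finitely many iterations. Either it reports infeasibility and (DEF) is infeasible, or it returns $(x,y)$ which, with the same $w$, is feasible for (DEF) and whose objective value $u$ satisfies $u\le v+\varepsilon|u|$ for the objective value $v$ of every feasible solution of (DEF). * The algorithm never gets stuck: for every $\varepsilon\ge0$, in every iteration that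 is reached and whose master problem is infeasible or has an optimal solution, all the steps above can be carried out. -/

import Mathlib

open Matrix

/-- Data and standing assumptions of a two-stage stochastic program with a multivariate
increasing-convex-order (ICO) benchmarking constraint, over a finite probability space.
Sizes: `n₁`, `n₂` first- and second-stage variables, `m` scenarios, `τ` benchmark
realizations, `d` performance criteria, `r` second-stage rows, `k` rows describing the
scalarization polytope. Smaller outcomes are preferred. -/
structure TwoStageICO (n₁ n₂ m τ d r k : ℕ) where
  /-- convex part of the first-stage feasible set -/
  K : Set (Fin n₁ → ℝ)
  /-- indices of the integer first-stage variables -/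
  intIdx : Set (Fin n₁)
  /-- first-stage cost -/
  f : (Fin n₁ → ℝ) → ℝ
  /-- scenario probabilities -/
  p : Fin m → ℝ
  /-- second-stage costs -/
  q : Fin m → Fin n₂ → ℝ
  /-- technology matrices -/
  Tm : Fin m → Matrix (Fin r) (Fin n₁) ℝ
  /-- recourse matrices -/
  Wm : Fin m → Matrix (Fin r) (Fin n₂) ℝ
  /-- second-stage right-hand sides -/
  h : Fin m → Fin r → ℝ
  /-- first-stage part of the outcome map -/
  gbar : Fin m → Matrix (Fin d) (Fin n₁) ℝ
  /-- second-stage part of the outcome map -/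
  gtil : Fin m → Matrix (Fin d) (Fin n₂) ℝ
  /-- realizations of the benchmark vector `Z` -/
  z : Fin τ → Fin d → ℝ
  /-- probabilities of the benchmark realizations -/
  ptil : Fin τ → ℝ
  /-- rows of the linear inequalities that cut the scalarization set out of the unit simplex -/
  A : Matrix (Fin k) (Fin d) ℝ
  /-- right-hand sides of these inequalities -/
  b : Fin k → ℝ
  convex_K : Convex ℝ K
  convexOn_f : ConvexOn ℝ K f
  nonempty_X : ∃ x ∈ K, (∀ i, 0 ≤ x i) ∧ ∀ i ∈ intIdx, ∃ n : ℤ, x i = n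
  p_nonneg : ∀ s, 0 ≤ p s
  p_sum : ∑ s, p s = 1
  ptil_nonneg : ∀ i, 0 ≤ ptil i
  ptil_sum : ∑ i, ptil i = 1
  nonempty_C : ∃ c ∈ stdSimplex ℝ (Fin d), A *ᵥ c ≤ b
  /-- the second-stage value is never `-∞` at a first-stage decision of the model -/
  recourse_bdd : ∀ x ∈ K, (∀ i, 0 ≤ x i) → (∀ i ∈ intIdx, ∃ n : ℤ, x i = n) →
    ∀ s, BddBelow ((fun y => q s ⬝ᵥ y) '' {y | 0 ≤ y ∧ h s ≤ Tm s *ᵥ x + Wm s *ᵥ y})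

namespace TwoStageICO

section

variable {n₁ n₂ m τ d r k : ℕ} (I : TwoStageICO n₁ n₂ m τ d r k)

/-! ### The model and its deterministic equivalent -/

/-- First-stage feasible set: nonnegative points of the convex set `K` whose coordinates
in `intIdx` are integers. -/
def X : Set (Fin n₁ → ℝ) :=
  {x | x ∈ I.K ∧ (∀ i, 0 ≤ x i) ∧ ∀ i ∈ I.intIdx, ∃ n : ℤ, x i = n}

/-- Second-stage feasible set `{y ≥ 0 : T_s x + W_s y ≥ h_s}`. -/
def Y (s : Fin m) (x : Fin n₁ → ℝ) : Set (Fin n₂ → ℝ) :=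
  {y | 0 ≤ y ∧ I.h s ≤ I.Tm s *ᵥ x + I.Wm s *ᵥ y}

/-- The polytope of scalarization vectors, a subset of the unit simplex. -/
def C : Set (Fin d → ℝ) :=
  {c | c ∈ stdSimplex ℝ (Fin d) ∧ I.A *ᵥ c ≤ I.b}

/-- Outcome vector in scenario `s`. -/
def outcome (s : Fin m) (x : Fin n₁ → ℝ) (y : Fin n₂ → ℝ) : Fin d → ℝ :=
  I.gbar s *ᵥ x + I.gtil s *ᵥ y

/-- Expected excess `E[(cᵀZ - cᵀz_t)₊]` of the benchmark. -/
def benchExcess (t : Fin τ) (c : Fin d → ℝ) : ℝ :=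
  ∑ i, I.ptil i * max (c ⬝ᵥ I.z i - c ⬝ᵥ I.z t) 0

/-- Excess `(cᵀĝ_s(x, y_s) - cᵀz_t)₊` of the decision-based outcome in scenario `s`. -/
def excess (x : Fin n₁ → ℝ) (y : Fin m → Fin n₂ → ℝ) (s : Fin m) (t : Fin τ)
    (c : Fin d → ℝ) : ℝ :=
  max (c ⬝ᵥ I.outcome s x (y s) - c ⬝ᵥ I.z t) 0

/-- The polyhedron
`P_t = {(c, w) : c ∈ C, w ≥ 0, w_i ≥ cᵀz_i - cᵀz_t for all i}`. -/
def P (t : Fin τ) : Set ((Fin d → ℝ) × (Fin τ → ℝ)) :=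
  {cw | cw.1 ∈ I.C ∧ 0 ≤ cw.2 ∧ ∀ i, cw.1 ⬝ᵥ I.z i - cw.1 ⬝ᵥ I.z t ≤ cw.2 i}

/-- Projections onto `c` of the vertices of `P_t`. -/
def vertexProj (t : Fin τ) : Set (Fin d → ℝ) :=
  Prod.fst '' Set.extremePoints ℝ (I.P t)

/-- The scalarization vectors used in the deterministic equivalent: the projections of the
vertices of all the `P_t`. -/
def vertexScal : Set (Fin d → ℝ) := ⋃ t, I.vertexProj t

/-- Objective of the deterministic equivalent. -/
def obj (x : Fin n₁ → ℝ) (y : Fin m → Fin n₂ → ℝ) : ℝ :=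
  I.f x + ∑ s, I.p s * (I.q s ⬝ᵥ y s)

/-- Feasibility in the deterministic equivalent formulation. -/
def DEFFeasible (x : Fin n₁ → ℝ) (w : Fin m → Fin τ → I.vertexScal → ℝ)
    (y : Fin m → Fin n₂ → ℝ) : Prop :=
  x ∈ I.X ∧
  (∀ s, y s ∈ I.Y s x) ∧
  (∀ t (c : I.vertexScal), ∑ s, I.p s * w s t c ≤ I.benchExcess t c) ∧
  (∀ s t (c : I.vertexScal),
    (c : Fin d → ℝ) ⬝ᵥ I.outcome s x (y s) - (c : Fin d → ℝ) ⬝ᵥ I.z t ≤ w s t c) ∧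
  (∀ s t c, 0 ≤ w s t c)

/-- Optimality in the deterministic equivalent formulation. -/
def DEFOptimal (x : Fin n₁ → ℝ) (w : Fin m → Fin τ → I.vertexScal → ℝ)
    (y : Fin m → Fin n₂ → ℝ) : Prop :=
  I.DEFFeasible x w y ∧ ∀ x' w' y', I.DEFFeasible x' w' y' → I.obj x y ≤ I.obj x' y'

/-! ### Second-stage subproblems and their duals -/

/-- Feasible set of the subproblem of scenario `s` for the scalarization vectors `c` at the
first-stage point `(x, w)`; here `w` is the block `w_s` of that scenario. -/
def SubFeas {L : ℕ} (c : Fin L → Fin d → ℝ) (s : Fin m) (x : Fin n₁ → ℝ)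
    (w : Fin τ → Fin L → ℝ) : Set (Fin n₂ → ℝ) :=
  {y | 0 ≤ y ∧ I.h s - I.Tm s *ᵥ x ≤ I.Wm s *ᵥ y ∧
    ∀ t l, c l ⬝ᵥ (I.gbar s *ᵥ x) - c l ⬝ᵥ I.z t - w t l ≤ -(c l ⬝ᵥ (I.gtil s *ᵥ y))}

/-- `y` is an optimal solution of the subproblem. -/
def SubOptimal {L : ℕ} (c : Fin L → Fin d → ℝ) (s : Fin m) (x : Fin n₁ → ℝ)
    (w : Fin τ → Fin L → ℝ) (y : Fin n₂ → ℝ) : Prop :=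
  y ∈ I.SubFeas c s x w ∧ ∀ y' ∈ I.SubFeas c s x w, I.q s ⬝ᵥ y ≤ I.q s ⬝ᵥ y'

/-- `W_sᵀγ - ∑_{t,l} β_{tl} g̃_sᵀ c_l`, the left-hand side of the dual constraints. -/
def dualLhs {L : ℕ} (c : Fin L → Fin d → ℝ) (s : Fin m)
    (g : (Fin r → ℝ) × (Fin τ → Fin L → ℝ)) : Fin n₂ → ℝ :=
  (I.Wm s)ᵀ *ᵥ g.1 - ∑ t, ∑ l, g.2 t l • ((I.gtil s)ᵀ *ᵥ c l)

/-- Feasible set of the dual of the subproblem, in the variables `(γ, β)`. -/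
def DualFeas {L : ℕ} (c : Fin L → Fin d → ℝ) (s : Fin m) :
    Set ((Fin r → ℝ) × (Fin τ → Fin L → ℝ)) :=
  {g | 0 ≤ g ∧ I.dualLhs c s g ≤ I.q s}

/-- Recession cone of the dual feasible set. -/
def DualCone {L : ℕ} (c : Fin L → Fin d → ℝ) (s : Fin m) :
    Set ((Fin r → ℝ) × (Fin τ → Fin L → ℝ)) :=
  {g | 0 ≤ g ∧ I.dualLhs c s g ≤ 0}

/-- Objective of the dual of the subproblem; also the right-hand side of the cuts. -/
def dualObj {L : ℕ} (c : Fin L → Fin d → ℝ) (s : Fin m) (x : Fin n₁ → ℝ)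
    (w : Fin τ → Fin L → ℝ) (g : (Fin r → ℝ) × (Fin τ → Fin L → ℝ)) : ℝ :=
  g.1 ⬝ᵥ (I.h s - I.Tm s *ᵥ x) +
    ∑ t, ∑ l, g.2 t l * (c l ⬝ᵥ (I.gbar s *ᵥ x) - c l ⬝ᵥ I.z t - w t l)

/-- `g` spans an extreme ray of the convex cone `K`. -/
def IsExtremeRay {E : Type*} [AddCommGroup E] [Module ℝ E] (K : Set E) (g : E) : Prop :=
  g ∈ K ∧ g ≠ 0 ∧ ∀ a ∈ K, ∀ b ∈ K, a + b = g → ∃ t : ℝ, 0 ≤ t ∧ a = t • g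

/-! ### Separation problems -/

/-- Objective of the separation problem of the `t`-th benchmark realization. -/
def sepObj (x : Fin n₁ → ℝ) (y : Fin m → Fin n₂ → ℝ) (t : Fin τ) (c : Fin d → ℝ) : ℝ :=
  I.benchExcess t c - ∑ s, I.p s * I.excess x y s t c

/-- `c` is an optimal solution over `C` of the `t`-th separation problem and the projection
of a vertex of `P_t`. -/
def SepVertexOptimal (x : Fin n₁ → ℝ) (y : Fin m → Fin n₂ → ℝ) (t : Fin τ)
    (c : Fin d → ℝ) : Prop :=
  c ∈ I.C ∧ (∀ c' ∈ I.C, I.sepObj x y t c ≤ I.sepObj x y t c') ∧ c ∈ I.vertexProj t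

/-! ### The algorithm -/

/-- A Benders cut: a scenario with dual multipliers `(γ, β)`. The multipliers `β` vanish for
scalarization vectors that were added after the cut. -/
structure Cut (m τ r : ℕ) where
  scen : Fin m
  γ : Fin r → ℝ
  β : Fin τ → ℕ → ℝ

/-- The cut of scenario `s` with multipliers `g`. -/
def mkCut {L : ℕ} (s : Fin m) (g : (Fin r → ℝ) × (Fin τ → Fin L → ℝ)) : Cut m τ r :=
  ⟨s, g.1, fun t l => if hl : l < L then g.2 t ⟨l, hl⟩ else 0⟩

/-- Right-hand side of a cut at the first-stage point `(x, w)`. -/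
def cutRhs {L : ℕ} (c : Fin L → Fin d → ℝ) (x : Fin n₁ → ℝ)
    (w : Fin m → Fin τ → Fin L → ℝ) (e : Cut m τ r) : ℝ :=
  I.dualObj c e.scen x (w e.scen) (e.γ, fun t l => e.β t l)

/-- Input of the algorithm: finitely many initial scalarization vectors in `C` (possibly none)
and, for every scenario, a valid affine lower bound on the second-stage value, which forms
the initial set of optimality cuts. -/
structure Start where
  L : ℕ
  c : Fin L → Fin d → ℝ
  c_mem : ∀ l, c l ∈ I.C
  slope : Fin m → Fin n₁ → ℝ
  const : Fin m → ℝ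
  valid : ∀ s, ∀ x ∈ I.X, ∀ y ∈ I.Y s x, slope s ⬝ᵥ x + const s ≤ I.q s ⬝ᵥ y

/-- Memory of the algorithm: the current scalarization vectors, the optimality and the
feasibility cuts, and the first- and second-stage solution that gave the current upper bound
`u`, with `none` for `u = ∞`. -/
structure State (n₁ n₂ m τ d r : ℕ) where
  L : ℕ
  c : Fin L → Fin d → ℝ
  optCuts : Set (Cut m τ r)
  feasCuts : Set (Cut m τ r)
  inc : Option ((Fin n₁ → ℝ) × (Fin m → Fin n₂ → ℝ))

/-- What the algorithm is doing before an iteration: running, stopped with the message that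
the problem is infeasible, or stopped with a solution. -/
inductive Status (n₁ n₂ m τ d r : ℕ) where
  | running (σ : State n₁ n₂ m τ d r)
  | infeasible
  | solved (x : Fin n₁ → ℝ) (y : Fin m → Fin n₂ → ℝ)

variable {I}

/-- Initial memory. -/
def Start.init (P : I.Start) : State n₁ n₂ m τ d r := ⟨P.L, P.c, ∅, ∅, none⟩

/-- Feasibility in the relaxed master problem. -/
def Start.MasterFeasible (P : I.Start) (σ : State n₁ n₂ m τ d r) (x : Fin n₁ → ℝ)
    (w : Fin m → Fin τ → Fin σ.L → ℝ) (θ : Fin m → ℝ) : Prop :=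
  x ∈ I.X ∧
  (∀ s, P.slope s ⬝ᵥ x + P.const s ≤ θ s) ∧
  (∀ e ∈ σ.optCuts, I.cutRhs σ.c x w e ≤ θ e.scen) ∧
  (∀ e ∈ σ.feasCuts, I.cutRhs σ.c x w e ≤ 0) ∧
  (∀ t l, ∑ s, I.p s * w s t l ≤ I.benchExcess t (σ.c l)) ∧
  (∀ s t l, 0 ≤ w s t l)

variable (I) in
/-- Objective of the relaxed master problem. -/
def masterObj (x : Fin n₁ → ℝ) (θ : Fin m → ℝ) : ℝ := I.f x + ∑ s, I.p s * θ s

/-- Optimality in the relaxed master problem. -/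
def Start.MasterOptimal (P : I.Start) (σ : State n₁ n₂ m τ d r) (x : Fin n₁ → ℝ)
    (w : Fin m → Fin τ → Fin σ.L → ℝ) (θ : Fin m → ℝ) : Prop :=
  P.MasterFeasible σ x w θ ∧
    ∀ x' w' θ', P.MasterFeasible σ x' w' θ' → I.masterObj x θ ≤ I.masterObj x' θ'

variable (I) in
/-- Stopping test: the master value `F` is within the relative tolerance `ε` of the upper
bound `u`; for `u ≥ 0` this is `(1 - ε) u ≤ F ≤ (1 + ε) u`. -/
def WithinTol (ε F : ℝ) (x : Fin n₁ → ℝ) (y : Fin m → Fin n₂ → ℝ) : Prop :=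
  I.obj x y - ε * |I.obj x y| ≤ F ∧ F ≤ I.obj x y + ε * |I.obj x y|

variable (I) in
/-- The part of an iteration after a failed stopping test, for the master solution
`(x, w, θ)`: solve the subproblems, add a feasibility cut from an extreme ray of the dual
along which the dual is unbounded for every infeasible subproblem and an optimality cut from
an optimal extreme point of the dual for every feasible subproblem whose value is
underestimated by `θ`; if all the subproblems are feasible, solve the separation problems and
either update the upper bound or add a scalarization vector. -/
def LoopBody (σ : State n₁ n₂ m τ d r) (x : Fin n₁ → ℝ)
    (w : Fin m → Fin τ → Fin σ.L → ℝ) (θ : Fin m → ℝ)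
    (σ' : State n₁ n₂ m τ d r) : Prop :=
  ∃ (y : Fin m → Fin n₂ → ℝ) (ray pt : Fin m → (Fin r → ℝ) × (Fin τ → Fin σ.L → ℝ))
    (O F : Set (Cut m τ r)),
    (∀ s, I.SubFeas σ.c s x (w s) = ∅ →
      IsExtremeRay (I.DualCone σ.c s) (ray s) ∧ 0 < I.dualObj σ.c s x (w s) (ray s)) ∧
    (∀ s, (I.SubFeas σ.c s x (w s)).Nonempty →
      I.SubOptimal σ.c s x (w s) (y s) ∧
      pt s ∈ Set.extremePoints ℝ (I.DualFeas σ.c s) ∧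
      ∀ g ∈ I.DualFeas σ.c s, I.dualObj σ.c s x (w s) g ≤ I.dualObj σ.c s x (w s) (pt s)) ∧
    F = σ.feasCuts ∪ {e | ∃ s, I.SubFeas σ.c s x (w s) = ∅ ∧ e = mkCut s (ray s)} ∧
    O = σ.optCuts ∪ {e | ∃ s, (I.SubFeas σ.c s x (w s)).Nonempty ∧
      θ s < I.q s ⬝ᵥ y s ∧ e = mkCut s (pt s)} ∧
    (((∃ s, I.SubFeas σ.c s x (w s) = ∅) ∧ σ' = ⟨σ.L, σ.c, O, F, σ.inc⟩) ∨
     ((∀ s, (I.SubFeas σ.c s x (w s)).Nonempty) ∧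
      ∃ cst : Fin τ → Fin d → ℝ, (∀ t, I.SepVertexOptimal x y t (cst t)) ∧
        (((∀ t, 0 ≤ I.sepObj x y t (cst t)) ∧ σ' = ⟨σ.L, σ.c, O, F, some (x, y)⟩) ∨
         ∃ t, I.sepObj x y t (cst t) < 0 ∧
          σ' = ⟨σ.L + 1, Fin.snoc σ.c (cst t), O, F, σ.inc⟩)))

/-- One iteration of the algorithm with tolerance `ε`, for any choice among optimal solutions,
extreme rays, dual extreme points and violated scalarization vectors. A stopped algorithm
stays as it is. -/
inductive Start.Next (P : I.Start) (ε : ℝ) :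
    Status n₁ n₂ m τ d r → Status n₁ n₂ m τ d r → Prop
  | infeasible (σ : State n₁ n₂ m τ d r) (hno : ∀ x w θ, ¬ P.MasterFeasible σ x w θ) :
      Start.Next P ε (.running σ) .infeasible
  | halt (σ : State n₁ n₂ m τ d r) (x w θ) (hopt : P.MasterOptimal σ x w θ)
      (xh : Fin n₁ → ℝ) (yh : Fin m → Fin n₂ → ℝ) (hinc : σ.inc = some (xh, yh))
      (htol : I.WithinTol ε (I.masterObj x θ) xh yh) :
      Start.Next P ε (.running σ) (.solved xh yh)
  | step (σ σ' : State n₁ n₂ m τ d r) (x w θ) (hopt : P.MasterOptimal σ x w θ)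
      (htol : ∀ xh yh, σ.inc = some (xh, yh) → ¬ I.WithinTol ε (I.masterObj x θ) xh yh)
      (hbody : I.LoopBody σ x w θ σ') :
      Start.Next P ε (.running σ) (.running σ')
  | infeasible_stay : Start.Next P ε .infeasible .infeasible
  | solved_stay (xh : Fin n₁ → ℝ) (yh : Fin m → Fin n₂ → ℝ) :
      Start.Next P ε (.solved xh yh) (.solved xh yh)

/-- A run of the algorithm with tolerance `ε`: `a j` is the status after `j` iterations. -/
def Start.IsRun (P : I.Start) (ε : ℝ) (a : ℕ → Status n₁ n₂ m τ d r) : Prop :=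
  a 0 = .running P.init ∧ ∀ j, P.Next ε (a j) (a (j + 1))

/-- The memory `σ` occurs before some iteration of the algorithm with tolerance `ε`. -/
def Start.Reachable (P : I.Start) (ε : ℝ) (σ : State n₁ n₂ m τ d r) : Prop :=
  Relation.ReflTransGen (P.Next ε) (.running P.init) (.running σ)

end

end TwoStageICO

/-! Everything rests on one principle: a concave function bounded below on a nonempty polyhedron
without lines attains its minimum at a vertex, and there are finitely many vertices
(`IsPolyhedron.exists_extremePoint_isMin`, `IsPolyhedron.finite_extremePoints`).

In a separation problem the benchmark excess is convex in `c`, so the objective is a difference of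
convex functions. Lifting to `P t` replaces this excess by a linear function of `w`, and what
remains is concave. Some projected vertex is therefore a worst scalarization vector
(`exists_sepVertexOptimal`), and the constraints for `vertexScal` imply those for all of `C`
(`DEFFeasible.icoFeasible`).

Correctness is a sandwich. The dual feasible sets do not depend on `(x, w)`, so by weak duality no
cut removes a feasible solution with its excesses as `w` and its second-stage costs as `θ`. A
multiplier extended by zero stays dual feasible when a scalarization vector is added. Hence every
master value is a lower bound (`Start.masterObj_le`), while every incumbent is feasible for all of
`C`.

For termination, solutions of the subproblems satisfy the constraints of the current scalarization
vectors, so a violated vector is a new element of the finite set `vertexScal`, and eventually none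
is added. The dual polyhedra are then fixed, with finitely many vertices and finitely many extreme
rays up to scaling, and a cut violated by the master solution must come from a new one. So some
iteration adds no violated cut. Its incumbent costs at most the current master value, the next
master has the same cuts, and hence the next master value equals the incumbent cost: the stopping
test succeeds for every nonnegative tolerance (`Start.not_forall_step_of_fixed`).

A run at tolerance zero fails only finitely many stopping tests, each with a positive gap, so it is
also a run for small tolerances. That no step gets stuck is linear programming duality, derived from
Farkas' lemma, together with the existence of vertices and extreme rays. -/

section Polyhedra

/-! ### Polyhedra, vertices and minima of concave functions -/

variable {E F : Type*} [AddCommGroup E] [Module ℝ E] [AddCommGroup F] [Module ℝ F]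

/-- A set cut out by finitely many linear inequalities. -/
def IsPolyhedron (S : Set E) : Prop :=
  ∃ (ι : Type) (_ : Finite ι) (a : ι → E →ₗ[ℝ] ℝ) (b : ι → ℝ), S = {x | ∀ i, a i x ≤ b i}

lemma isPolyhedron_le (f : E →ₗ[ℝ] ℝ) (b : ℝ) : IsPolyhedron {x | f x ≤ b} :=
  ⟨Unit, inferInstance, fun _ => f, fun _ => b, by simp⟩

lemma isPolyhedron_ge (f : E →ₗ[ℝ] ℝ) (b : ℝ) : IsPolyhedron {x | b ≤ f x} :=
  ⟨Unit, inferInstance, fun _ => -f, fun _ => -b, by simp⟩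

lemma IsPolyhedron.inter {S T : Set E} (hS : IsPolyhedron S) (hT : IsPolyhedron T) :
    IsPolyhedron (S ∩ T) := by
  obtain ⟨ι, _, a, b, rfl⟩ := hS
  obtain ⟨κ, _, a', b', rfl⟩ := hT
  exact ⟨ι ⊕ κ, inferInstance, Sum.elim a a', Sum.elim b b', by ext; simp⟩

lemma IsPolyhedron.setOf_and {p q : E → Prop} (hp : IsPolyhedron {x | p x})
    (hq : IsPolyhedron {x | q x}) : IsPolyhedron {x | p x ∧ q x} := hp.inter hq

lemma IsPolyhedron.setOf_forall {κ : Type} [Finite κ] {p : κ → E → Prop}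
    (h : ∀ k, IsPolyhedron {x | p k x}) : IsPolyhedron {x | ∀ k, p k x} := by
  choose ι hι a b hab using h
  refine ⟨Σ k, ι k, inferInstance, fun i => a i.1 i.2, fun i => b i.1 i.2, ?_⟩
  ext x
  simp only [Set.mem_ofPred_eq, Sigma.forall]
  exact forall_congr' fun k => by simpa using Set.ext_iff.1 (hab k) x

lemma isPolyhedron_eq (f : E →ₗ[ℝ] ℝ) (b : ℝ) : IsPolyhedron {x | f x = b} := by
  simpa only [le_antisymm_iff] using (isPolyhedron_le f b).setOf_and (isPolyhedron_ge f b)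

lemma IsPolyhedron.preimage {S : Set F} (hS : IsPolyhedron S) (f : E →ₗ[ℝ] F) :
    IsPolyhedron (f ⁻¹' S) := by
  obtain ⟨ι, _, a, b, rfl⟩ := hS
  exact ⟨ι, inferInstance, fun i => a i ∘ₗ f, b, rfl⟩

lemma IsPolyhedron.convex {S : Set E} (hS : IsPolyhedron S) : Convex ℝ S := by
  obtain ⟨ι, _, a, b, rfl⟩ := hS
  rw [Set.ofPred_forall]
  exact convex_iInter fun i => convex_halfSpace_le (a i).isLinear (b i)

/-- From a point of a polyhedron one can move a little along a direction that does not leave any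
active constraint. -/
lemma exists_pos_forall_add_smul_le {ι : Type*} [Finite ι] (a : ι → E →ₗ[ℝ] ℝ) (b : ι → ℝ)
    {x v : E} (hx : ∀ i, a i x ≤ b i) (hv : ∀ i, a i x = b i → a i v ≤ 0) :
    ∃ δ : ℝ, 0 < δ ∧ ∀ i, a i (x + δ • v) ≤ b i := by
  have h : ∀ᶠ δ : ℝ in nhdsWithin 0 (Set.Ioi 0), ∀ i, a i (x + δ • v) ≤ b i := by
    rw [Filter.eventually_all]
    intro i
    simp only [map_add, map_smul, smul_eq_mul]
    rcases (hx i).eq_or_lt with h | h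
    · filter_upwards [self_mem_nhdsWithin] with δ hδ
      have := mul_nonpos_of_nonneg_of_nonpos (le_of_lt hδ) (hv i h)
      linarith
    · have hc : Filter.Tendsto (fun δ : ℝ => a i x + δ * a i v) (nhdsWithin 0 (Set.Ioi 0))
          (nhds (a i x + 0 * a i v)) :=
        ((continuous_const.add (continuous_id.mul continuous_const)).tendsto 0).mono_left
          nhdsWithin_le_nhds
      rw [zero_mul, add_zero] at hc
      exact (hc.eventually_lt_const h).mono fun _ => le_of_lt
  obtain ⟨δ, h1, h2⟩ := (h.and self_mem_nhdsWithin).exists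
  exact ⟨δ, h2, h1⟩

/-- A vertex is determined by its set of active constraints: if `y` has the same active set as the
vertex `x`, one can move from `x` a little away from `y`, which puts `x` strictly between two points
of the polyhedron unless `x = y`. -/
lemma IsPolyhedron.finite_extremePoints {S : Set E} (hS : IsPolyhedron S) :
    (S.extremePoints ℝ).Finite := by
  obtain ⟨ι, _, a, b, rfl⟩ := hS
  refine Set.Finite.of_injOn (f := fun x => {i | a i x = b i}) (t := Set.univ)
    (fun _ _ => Set.mem_univ _) ?_ Set.finite_univ
  intro x hx y hy hxy
  obtain ⟨δ, hδ, h⟩ := exists_pos_forall_add_smul_le a b (x := x) (v := x - y) hx.1 (by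
    intro i hi
    have : a i y = b i := (Set.ext_iff.1 hxy i).1 hi
    simp [hi, this])
  have := (mem_extremePoints.1 hx).2 _ h _ hy.1 ⟨1 / (1 + δ), δ / (1 + δ), by positivity,
    by positivity, by field_simp, by
      rw [show x + δ • (x - y) = (1 + δ) • x - δ • y by module, smul_sub, smul_smul, smul_smul,
        one_div_mul_cancel (by positivity), one_div_mul_eq_div, one_smul, sub_add_cancel]⟩
  exact this.2.symm

/-- Moving along a direction that keeps the active constraints active and is blocked by some
constraint leads to a point with more active constraints. -/
lemma exists_pos_active_ssubset {ι : Type*} [Finite ι] (a : ι → E →ₗ[ℝ] ℝ) (b : ι → ℝ)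
    {x v : E} (hx : ∀ i, a i x ≤ b i) (hv : ∀ i, a i x = b i → a i v = 0)
    (hblock : ∃ i, 0 < a i v) :
    ∃ T : ℝ, 0 < T ∧ (∀ i, a i (x + T • v) ≤ b i) ∧
      {i | a i (x + T • v) < b i} ⊂ {i | a i x < b i} := by
  -- Ratio test: `j` is the first constraint to become tight along `v`.
  obtain ⟨j, hj, hmin⟩ := Set.exists_min_image {i | 0 < a i v} (fun i => (b i - a i x) / a i v)
    (Set.toFinite _) hblock
  have hj' : 0 < a j v := hj
  have hlt : a j x < b j := lt_of_le_of_ne (hx j) fun h => by simp [hv j h] at hj'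
  have hT : 0 < (b j - a j x) / a j v := div_pos (by linarith) hj'
  set T := (b j - a j x) / a j v with hTdef
  have hle : ∀ i, a i (x + T • v) ≤ b i := by
    intro i
    simp only [map_add, map_smul, smul_eq_mul]
    rcases le_or_gt (a i v) 0 with h | h
    · have := mul_nonpos_of_nonneg_of_nonpos hT.le h
      linarith [hx i]
    · have := (le_div_iff₀ h).1 (hmin i h)
      linarith
  refine ⟨T, hT, hle, ⟨?_, ?_⟩⟩
  · intro i hi
    refine lt_of_le_of_ne (hx i) fun h => ?_
    simp [hv i h, h] at hi
  · intro h
    have h2 : a j (x + T • v) < b j := h hlt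
    simp only [map_add, map_smul, smul_eq_mul, hTdef] at h2
    rw [div_mul_cancel₀ _ hj'.ne'] at h2
    linarith

/-- A concave function that stays above `M` along a half-line does not decrease along it. -/
lemma ConcaveOn.le_of_forall_bddBelow {S : Set E} {φ : E → ℝ} (hφ : ConcaveOn ℝ S φ) {M : ℝ}
    (hM : ∀ x ∈ S, M ≤ φ x) {x v : E} {T : ℝ} (hT : 0 < T) (hTS : x + T • v ∈ S)
    (hray : ∀ s : ℝ, 0 ≤ s → x - s • v ∈ S) : φ (x + T • v) ≤ φ x := by
  by_contra! hlt
  set D := φ (x + T • v) - φ x with hD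
  have hDpos : 0 < D := by linarith
  have hx : x ∈ S := by simpa using hray 0 le_rfl
  -- Going back by this `s`, the slope `D / T` forces the value at `x - s • v` down to `M - 1` or
  -- less.
  obtain ⟨s, hs⟩ : ∃ s, s = T * (φ x - M + 1) / D := ⟨_, rfl⟩
  have hspos : 0 < s := hs ▸ div_pos (mul_pos hT (by linarith [hM x hx])) hDpos
  have h := hφ.2 hTS (hray s hspos.le) (show 0 ≤ s / (s + T) by positivity)
    (show 0 ≤ T / (s + T) by positivity) (by field_simp)
  have heq : (s / (s + T)) • (x + T • v) + (T / (s + T)) • (x - s • v) = x := by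
    have : (s / (s + T)) + (T / (s + T)) = 1 := by field_simp
    have h2 : (s / (s + T)) * T = (T / (s + T)) * s := by ring
    calc _ = ((s / (s + T)) + (T / (s + T))) • x + ((s / (s + T)) * T - (T / (s + T)) * s) • v := by
          module
      _ = x := by rw [this, h2]; simp
  rw [heq, smul_eq_mul, smul_eq_mul, div_mul_eq_mul_div, div_mul_eq_mul_div, ← add_div,
    div_le_iff₀ (by positivity)] at h
  have h3 := hM _ (hray s hspos.le)
  have h4 : s * D = T * (φ x - M + 1) := by rw [hs]; field_simp
  have h5 := mul_le_mul_of_nonneg_left h3 hT.le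
  have h6 : s * D = s * φ (x + T • v) - s * φ x := by rw [hD]; ring
  nlinarith

/-- On a polyhedron without lines, a concave function that is bounded below takes at some vertex
a value that is at most its value at a given point. -/
lemma IsPolyhedron.exists_extremePoint_le {S : Set E} (hS : IsPolyhedron S)
    (hline : ∀ x v, (∀ t : ℝ, x + t • v ∈ S) → v = 0) {φ : E → ℝ} (hφ : ConcaveOn ℝ S φ)
    {M : ℝ} (hM : ∀ x ∈ S, M ≤ φ x) {x : E} (hx : x ∈ S) :
    ∃ e ∈ S.extremePoints ℝ, φ e ≤ φ x := by
  obtain ⟨ι, _, a, b, rfl⟩ := hS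
  -- Induction on the number of inactive constraints: a point that is not a vertex is moved, without
  -- increasing `φ`, to one with fewer.
  induction hn : {i | a i x < b i}.ncard using Nat.strong_induction_on generalizing x with
  | _ n ih =>
  subst hn
  have key : ∀ y, (∀ i, a i y ≤ b i) → {i | a i y < b i} ⊂ {i | a i x < b i} → φ y ≤ φ x →
      ∃ e ∈ Set.extremePoints ℝ {x | ∀ i, a i x ≤ b i}, φ e ≤ φ x := by
    intro y hy hss hle
    obtain ⟨e, he, hle'⟩ := ih _ (Set.ncard_lt_ncard hss (Set.toFinite _)) hy rfl
    exact ⟨e, he, hle'.trans hle⟩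
  by_cases hex : x ∈ Set.extremePoints ℝ {x | ∀ i, a i x ≤ b i}
  · exact ⟨x, hex, le_rfl⟩
  have : ∃ y z : E, (∀ i, a i y ≤ b i) ∧ (∀ i, a i z ≤ b i) ∧ x ∈ openSegment ℝ y z ∧ y ≠ z := by
    by_contra! hcon
    refine hex (mem_extremePoints.2 ⟨hx, fun y hy z hz hxyz => ?_⟩)
    obtain rfl := hcon y z hy hz hxyz
    rw [openSegment_same] at hxyz
    exact ⟨hxyz.symm, hxyz.symm⟩
  obtain ⟨y, z, hy, hz, ⟨α, β, hα, hβ, hαβ, hxe⟩, hne⟩ := this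
  have hact : ∀ i, a i x = b i → a i (z - y) = 0 := by
    intro i hi
    have h1 : α * a i y + β * a i z = b i := by
      rw [← hi, ← hxe]; simp
    have h2 := hy i
    have h3 := hz i
    have h4 : α * (b i - a i y) + β * (b i - a i z) = 0 := by
      linear_combination (b i) * hαβ - h1
    have h5 := mul_nonneg hα.le (sub_nonneg.2 h2)
    have h6 := mul_nonneg hβ.le (sub_nonneg.2 h3)
    have h7 : b i - a i y = 0 := (mul_eq_zero.1 (by linarith)).resolve_left hα.ne'
    have h8 : b i - a i z = 0 := (mul_eq_zero.1 (by linarith)).resolve_left hβ.ne'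
    rw [map_sub]; linarith
  have hdir : ∃ v : E, (∀ i, a i x = b i → a i v = 0) ∧ ∃ i, 0 < a i v := by
    have : ∃ i, a i (z - y) ≠ 0 := by
      by_contra! h0
      refine hne (sub_eq_zero.1 (hline x (z - y) fun t i => ?_)).symm
      rw [map_add, map_smul, h0 i]; simpa using hx i
    obtain ⟨i, hi⟩ := this
    rcases hi.lt_or_gt with h | h
    · exact ⟨-(z - y), fun j hj => by rw [map_neg, hact j hj, neg_zero], i, by
        rw [map_neg]; linarith⟩
    · exact ⟨z - y, hact, i, h⟩
  obtain ⟨v, hv, hvb⟩ := hdir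
  obtain ⟨T, hT, hTS, hTss⟩ := exists_pos_active_ssubset a b hx hv hvb
  -- If both directions are blocked, `x` lies between two points with more active constraints and
  -- concavity selects one of them. Otherwise the half-line along `-v` stays inside, and boundedness
  -- below makes moving along `v` harmless.
  by_cases hnb : ∃ i, 0 < a i (-v)
  · obtain ⟨T', hT', hTS', hTss'⟩ := exists_pos_active_ssubset a b hx
      (fun i hi => by rw [map_neg, hv i hi, neg_zero]) hnb
    have hmin := hφ.min_le_of_mem_segment (x := x + T • v) (y := x + T' • -v) (z := x) hTS hTS'
      ⟨T' / (T + T'), T / (T + T'), by positivity, by positivity, by field_simp; ring, by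
        have h1 : T' / (T + T') + T / (T + T') = 1 := by field_simp; ring
        have h2 : T' / (T + T') * T = T / (T + T') * T' := by ring
        calc _ = (T' / (T + T') + T / (T + T')) • x +
              (T' / (T + T') * T - T / (T + T') * T') • v := by module
          _ = x := by rw [h1, h2]; simp⟩
    rcases min_le_iff.1 hmin with h | h
    · exact key _ hTS hTss h
    · exact key _ hTS' hTss' h
  · push Not at hnb
    refine key _ hTS hTss (hφ.le_of_forall_bddBelow hM hT hTS fun s hs i => ?_)
    have h1 := hnb i
    rw [map_neg] at h1
    have := mul_nonneg hs (neg_nonpos.1 h1 : 0 ≤ a i v)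
    simp only [map_sub, map_smul, smul_eq_mul]
    linarith [hx i]

/-- A concave function that is bounded below on a nonempty polyhedron without lines attains its
minimum at a vertex. -/
lemma IsPolyhedron.exists_extremePoint_isMin {S : Set E} (hS : IsPolyhedron S)
    (hline : ∀ x v, (∀ t : ℝ, x + t • v ∈ S) → v = 0) {φ : E → ℝ} (hφ : ConcaveOn ℝ S φ)
    {M : ℝ} (hM : ∀ x ∈ S, M ≤ φ x) (hne : S.Nonempty) :
    ∃ e ∈ S.extremePoints ℝ, ∀ x ∈ S, φ e ≤ φ x := by
  obtain ⟨x₀, hx₀⟩ := hne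
  obtain ⟨e₀, he₀, -⟩ := hS.exists_extremePoint_le hline hφ hM hx₀
  obtain ⟨e, he, hmin⟩ := Set.exists_min_image _ φ hS.finite_extremePoints ⟨e₀, he₀⟩
  refine ⟨e, he, fun x hx => ?_⟩
  obtain ⟨e', he', hle⟩ := hS.exists_extremePoint_le hline hφ hM hx
  exact (hmin e' he').trans hle

/-- The nonnegative orthant contains no line. -/
lemma eq_zero_of_forall_nonneg_add_smul {ι : Type*} {x v : ι → ℝ}
    (h : ∀ t : ℝ, ∀ i, 0 ≤ x i + t * v i) : v = 0 := by
  funext i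
  by_contra hv
  have hv' : v i ≠ 0 := hv
  -- This parameter makes the coordinate equal to `-1`.
  have h1 := h (-(x i + 1) / v i) i
  rw [div_mul_cancel₀ _ hv'] at h1
  linarith

end Polyhedra

namespace TwoStageICO

/-! ### Extreme rays of pointed polyhedral cones -/

section Rays

variable {E : Type*} [AddCommGroup E] [Module ℝ E] {K : Set E}

lemma IsExtremeRay.smul (hsmul : ∀ g ∈ K, ∀ t : ℝ, 0 ≤ t → t • g ∈ K) {g : E}
    (hg : IsExtremeRay K g) {α : ℝ} (hα : 0 < α) : IsExtremeRay K (α • g) := by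
  refine ⟨hsmul g hg.1 α hα.le, smul_ne_zero hα.ne' hg.2.1, fun a ha b hb hab => ?_⟩
  obtain ⟨t, ht, h⟩ := hg.2.2 (α⁻¹ • a) (hsmul a ha _ (by positivity)) (α⁻¹ • b)
    (hsmul b hb _ (by positivity)) (by rw [← smul_add, hab, inv_smul_smul₀ hα.ne'])
  refine ⟨t, ht, ?_⟩
  rw [smul_comm, ← h, smul_inv_smul₀ hα.ne']

/-- Normalized extreme rays are vertices of a slice of the cone. -/
lemma IsExtremeRay.mem_extremePoints_slice
    (hsmul : ∀ g ∈ K, ∀ t : ℝ, 0 ≤ t → t • g ∈ K) {ℓ : E →ₗ[ℝ] ℝ} {g : E}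
    (hg : IsExtremeRay K g) (hℓ : ℓ g = 1) : g ∈ Set.extremePoints ℝ (K ∩ {x | ℓ x = 1}) := by
  have key : ∀ x ∈ K ∩ {x | ℓ x = 1}, ∀ y ∈ K ∩ {x | ℓ x = 1}, ∀ s t : ℝ, 0 < s → 0 < t →
      s • x + t • y = g → x = g := by
    intro x hx y hy s t hs ht h
    obtain ⟨u, hu, hxu⟩ := hg.2.2 (s • x) (hsmul x hx.1 s hs.le) (t • y) (hsmul y hy.1 t ht.le) h
    have h1 : s = u := by
      have := congrArg ℓ hxu
      rw [map_smul, map_smul, hℓ, show ℓ x = 1 from hx.2] at this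
      simpa using this
    subst h1
    exact smul_right_injective E hs.ne' hxu
  refine mem_extremePoints.2 ⟨⟨hg.1, hℓ⟩, ?_⟩
  rintro x hx y hy ⟨s, t, hs, ht, -, h⟩
  exact ⟨key x hx y hy s t hs ht h, key y hy x hx t s ht hs (by rw [add_comm, h])⟩

/-- A polyhedral cone on which some linear functional is positive away from the origin has
finitely many extreme rays up to scaling. -/
lemma exists_finite_extremeRays (hK : IsPolyhedron K)
    (hsmul : ∀ g ∈ K, ∀ t : ℝ, 0 ≤ t → t • g ∈ K) {ℓ : E →ₗ[ℝ] ℝ}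
    (hℓ : ∀ g ∈ K, g ≠ 0 → 0 < ℓ g) :
    ∃ R : Set E, R.Finite ∧ ∀ g, IsExtremeRay K g → ∃ α : ℝ, 0 < α ∧ ∃ e ∈ R, g = α • e := by
  refine ⟨_, (hK.inter (isPolyhedron_eq ℓ 1)).finite_extremePoints, fun g hg => ?_⟩
  have h := hℓ g hg.1 hg.2.1
  refine ⟨ℓ g, h, (ℓ g)⁻¹ • g, ?_, by rw [smul_inv_smul₀ h.ne']⟩
  exact (hg.smul hsmul (inv_pos.2 h)).mem_extremePoints_slice hsmul (by
    rw [map_smul, smul_eq_mul, inv_mul_cancel₀ h.ne'])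

/-- A vertex of a slice of a pointed cone is an extreme ray. -/
lemma isExtremeRay_of_mem_extremePoints_slice
    (hsmul : ∀ g ∈ K, ∀ t : ℝ, 0 ≤ t → t • g ∈ K)
    (hadd : ∀ g ∈ K, ∀ g' ∈ K, g + g' ∈ K) (hpt : ∀ g ∈ K, -g ∈ K → g = 0)
    {D : E →ₗ[ℝ] ℝ} {g : E} (hg : g ∈ Set.extremePoints ℝ (K ∩ {x | D x = 1})) :
    IsExtremeRay K g := by
  obtain ⟨⟨hgK, hgD⟩, hext⟩ := mem_extremePoints.1 hg
  have hgD' : D g = 1 := hgD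
  refine ⟨hgK, fun h => by simp [h] at hgD', fun a ha b hb hab => ?_⟩
  have hDab : D a + D b = 1 := by rw [← map_add, hab, hgD']
  -- With this `δ`, both `g ± δ • (a - D a • g)` are nonnegative combinations of elements of the
  -- cone, the second after writing `g = a + b`. Extremality of `g` in the slice then forces `a = D
  -- a • g`.
  have hδ : ∃ δ : ℝ, 0 < δ ∧ δ * (1 + |D a|) ≤ 1 :=
    ⟨1 / (1 + |D a|), by positivity, by field_simp; exact le_rfl⟩
  obtain ⟨δ, hδ, hδ1⟩ := hδ
  have h1 : δ * D a ≤ δ * |D a| := mul_le_mul_of_nonneg_left (le_abs_self _) hδ.le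
  have h2 : -(δ * |D a|) ≤ δ * D a := by
    have := mul_le_mul_of_nonneg_left (neg_abs_le (D a)) hδ.le
    linarith
  have hmem1 : g + δ • (a - D a • g) ∈ K ∩ {x | D x = 1} := by
    refine ⟨?_, by simp [hgD']⟩
    rw [show g + δ • (a - D a • g) = (1 - δ * D a) • g + δ • a by module]
    exact hadd _ (hsmul g hgK _ (by linarith)) _ (hsmul a ha _ hδ.le)
  have hmem2 : g - δ • (a - D a • g) ∈ K ∩ {x | D x = 1} := by
    refine ⟨?_, by simp [hgD']⟩
    rw [show g - δ • (a - D a • g) = (1 + δ * D a) • g - δ • a by module, ← hab,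
      show (1 + δ * D a) • (a + b) - δ • a = (1 + δ * D a - δ) • a + (1 + δ * D a) • b by module]
    exact hadd _ (hsmul a ha _ (by linarith)) _ (hsmul b hb _ (by linarith))
  have h3 := (hext _ hmem1 _ hmem2 ⟨1 / 2, 1 / 2, by norm_num, by norm_num, by norm_num, by
    module⟩).1
  have h4 : a = D a • g := by
    have : δ • (a - D a • g) = 0 := by simpa using h3
    exact sub_eq_zero.1 ((smul_eq_zero.1 this).resolve_left hδ.ne')
  -- A negative `D a` would put `-g` into the cone.
  by_cases hneg : 0 ≤ D a
  · exact ⟨D a, hneg, h4⟩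
  · push Not at hneg
    exfalso
    have h5 : -g ∈ K := by
      have h6 : -(D a)⁻¹ * D a = -1 := by rw [neg_mul, inv_mul_cancel₀ hneg.ne]
      have := hsmul a ha (-(D a)⁻¹) (by simpa using hneg.le)
      rwa [h4, map_smul, hgD', smul_eq_mul, mul_one, smul_smul, h6, neg_one_smul] at this
    have := hpt g hgK h5
    simp [this] at hgD'

/-- If a linear functional is positive somewhere on a pointed polyhedral cone, then it is positive
on some extreme ray. -/
lemma exists_extremeRay_pos (hK : IsPolyhedron K)
    (hsmul : ∀ g ∈ K, ∀ t : ℝ, 0 ≤ t → t • g ∈ K)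
    (hadd : ∀ g ∈ K, ∀ g' ∈ K, g + g' ∈ K)
    (hline : ∀ x v, (∀ t : ℝ, x + t • v ∈ K) → v = 0)
    {D : E →ₗ[ℝ] ℝ} {g : E} (hg : g ∈ K) (hD : 0 < D g) :
    ∃ e, IsExtremeRay K e ∧ 0 < D e := by
  have hpt : ∀ g ∈ K, -g ∈ K → g = 0 := by
    intro g hg hg'
    refine hline 0 g fun t => ?_
    rw [zero_add]
    rcases le_total 0 t with h | h
    · exact hsmul g hg t h
    · simpa using hsmul (-g) hg' (-t) (by linarith)
  have hpoly := hK.inter (isPolyhedron_eq D 1)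
  -- The slice is nonempty and contains no line. Only the existence of a vertex is wanted, hence `φ
  -- = 0`.
  obtain ⟨e, he, -⟩ := hpoly.exists_extremePoint_le (φ := fun _ => (0 : ℝ)) (M := 0)
    (fun x v h => hline x v fun t => (h t).1)
    (concaveOn_const _ hpoly.convex)
    (fun _ _ => le_rfl) (x := (D g)⁻¹ • g)
    ⟨hsmul g hg _ (by positivity), by simp [hD.ne']⟩
  refine ⟨e, isExtremeRay_of_mem_extremePoints_slice hsmul hadd hpt he, ?_⟩
  rw [show D e = 1 from he.1.2]
  exact one_pos

end Rays

end TwoStageICO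

/-! ### Farkas' lemma and linear programming duality -/

section LinearProgramming

/-- **Farkas' lemma** for finitely many linear functionals on an arbitrary vector space. -/
theorem exists_nonneg_combination {E ι : Type*} [AddCommGroup E] [Module ℝ E] (s : Finset ι)
    (a : ι → E →ₗ[ℝ] ℝ) (γ : E →ₗ[ℝ] ℝ) (h : ∀ x, (∀ i ∈ s, a i x ≤ 0) → γ x ≤ 0) :
    ∃ u : ι → ℝ, (∀ i, 0 ≤ u i) ∧ γ = ∑ i ∈ s, u i • a i := by
  classical
  induction s using Finset.induction_on generalizing a γ with
  | empty =>
    refine ⟨0, fun _ => le_rfl, ?_⟩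
    ext x
    have h1 := h x (by simp)
    have h2 := h (-x) (by simp)
    rw [map_neg] at h2
    simp only [Finset.sum_empty, LinearMap.zero_apply]
    linarith
  | insert j s hj ih =>
    by_cases hs : ∀ x, (∀ i ∈ s, a i x ≤ 0) → γ x ≤ 0
    · obtain ⟨u, hu, hγ⟩ := ih a γ hs
      refine ⟨fun i => if i = j then 0 else u i, fun i => ?_, ?_⟩
      · dsimp only
        split_ifs
        exacts [le_rfl, hu i]
      · rw [Finset.sum_insert hj]
        dsimp only
        rw [if_pos rfl, zero_smul, zero_add, hγ]
        refine Finset.sum_congr rfl fun i hi => ?_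
        rw [if_neg (ne_of_mem_of_not_mem hi hj)]
    · push Not at hs
      obtain ⟨x₁, hx₁, hγ₁⟩ := hs
      have hpos : 0 < a j x₁ := by
        by_contra! hneg
        exact absurd (h x₁ (Finset.forall_mem_insert _ _ _ |>.2 ⟨hneg, hx₁⟩)) (not_le.2 hγ₁)
      -- Projecting along `x₀` onto the kernel of `a j` eliminates this functional, and the
      -- induction hypothesis applies to the projected ones.
      set x₀ := (a j x₁)⁻¹ • x₁ with hx₀def
      have hj0 : a j x₀ = 1 := by simp [hx₀def, hpos.ne']
      have hx₀ : ∀ i ∈ s, a i x₀ ≤ 0 := fun i hi => by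
        rw [hx₀def, map_smul]
        exact mul_nonpos_of_nonneg_of_nonpos (inv_nonneg.2 hpos.le) (hx₁ i hi)
      have hγ₀ : 0 < γ x₀ := by
        rw [hx₀def, map_smul]
        exact mul_pos (inv_pos.2 hpos) hγ₁
      obtain ⟨u, hu, hγ⟩ := ih (fun i => a i - a i x₀ • a j) (γ - γ x₀ • a j) (by
        intro x hx
        have := h (x - a j x • x₀) (Finset.forall_mem_insert _ _ _ |>.2 ⟨by simp [hj0], by
          intro i hi
          have := hx i hi
          simp only [LinearMap.sub_apply, LinearMap.smul_apply, smul_eq_mul] at this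
          simp only [map_sub, map_smul, smul_eq_mul]
          linarith⟩)
        simp only [map_sub, map_smul, smul_eq_mul] at this
        simp only [LinearMap.sub_apply, LinearMap.smul_apply, smul_eq_mul]
        linarith)
      -- The multiplier of `a j` collects the corrections from the projection. It is nonnegative
      -- since `γ x₀ > 0` and `a i x₀ ≤ 0` on `s`.
      refine ⟨fun i => if i = j then γ x₀ - ∑ i ∈ s, u i * a i x₀ else u i, fun i => ?_, ?_⟩
      · dsimp only
        split_ifs
        · have : ∑ i ∈ s, u i * a i x₀ ≤ 0 := Finset.sum_nonpos fun i hi =>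
            mul_nonpos_of_nonneg_of_nonpos (hu i) (hx₀ i hi)
          linarith
        · exact hu i
      · rw [Finset.sum_insert hj]
        dsimp only
        rw [if_pos rfl, Finset.sum_congr rfl (g := fun i => u i • a i)
          fun i hi => by rw [if_neg (ne_of_mem_of_not_mem hi hj)]]
        rw [sub_eq_iff_eq_add] at hγ
        ext x
        have hx := LinearMap.congr_fun hγ x
        simp only [LinearMap.add_apply, LinearMap.sub_apply, LinearMap.smul_apply, smul_eq_mul,
          LinearMap.sum_apply] at hx ⊢
        rw [hx, sub_mul, Finset.sum_mul]
        simp only [mul_sub, Finset.sum_sub_distrib, mul_assoc]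
        ring

variable {ι : Type*} [Fintype ι] {n : ℕ} (A : Matrix ι (Fin n) ℝ) (b : ι → ℝ)

/-- **Farkas' lemma** for the system `A y ≥ b`, `y ≥ 0`. -/
theorem exists_dual_ray_of_infeasible (h : ∀ y, 0 ≤ y → ¬ b ≤ A *ᵥ y) :
    ∃ u : ι → ℝ, 0 ≤ u ∧ u ᵥ* A ≤ 0 ∧ 0 < u ⬝ᵥ b := by
  -- Homogenization: on the cone `b t ≤ A y`, `y ≥ 0`, `t ≥ 0`, infeasibility of the system means `t
  -- ≤ 0`. The multipliers from Farkas' lemma are read off at `(e_j, 0)` and `(0, 1)`.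
  let pr : Fin n → ((Fin n → ℝ) × ℝ) →ₗ[ℝ] ℝ := fun j =>
    LinearMap.proj j ∘ₗ LinearMap.fst ℝ (Fin n → ℝ) ℝ
  let sn : ((Fin n → ℝ) × ℝ) →ₗ[ℝ] ℝ := LinearMap.snd ℝ (Fin n → ℝ) ℝ
  let a : ι ⊕ (Fin n ⊕ Unit) → ((Fin n → ℝ) × ℝ) →ₗ[ℝ] ℝ :=
    Sum.elim (fun i => b i • sn - ∑ j, A i j • pr j)
      (Sum.elim (fun j => - pr j) (fun _ => -sn))
  have ha1 : ∀ i y t, a (.inl i) (y, t) = b i * t - (A *ᵥ y) i := by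
    intro i y t
    simp [a, pr, sn, Matrix.mulVec, dotProduct]
  have ha2 : ∀ j y t, a (.inr (.inl j)) (y, t) = -y j := fun j y t => by simp [a, pr]
  have ha3 : ∀ y t, a (.inr (.inr ())) (y, t) = -t := fun y t => by simp [a, sn]
  obtain ⟨u, hu, hsum⟩ := exists_nonneg_combination Finset.univ a sn (by
    rintro ⟨y, t⟩ hyt
    simp only [Finset.mem_univ, forall_const] at hyt
    change t ≤ 0
    by_contra! ht
    refine h (t⁻¹ • y) (fun j => ?_) (fun i => ?_)
    · have := hyt (.inr (.inl j))
      rw [ha2] at this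
      simpa using mul_nonneg (inv_nonneg.2 ht.le) (by linarith : 0 ≤ y j)
    · have := hyt (.inl i)
      rw [ha1] at this
      rw [mulVec_smul, Pi.smul_apply, smul_eq_mul, inv_mul_eq_div, le_div_iff₀ ht]
      linarith)
  have heval : ∀ y t, t = ∑ i, u i * a i (y, t) := fun y t => by
    simpa only [LinearMap.sum_apply, LinearMap.smul_apply, smul_eq_mul, sn,
      LinearMap.snd_apply] using LinearMap.congr_fun hsum (y, t)
  refine ⟨fun i => u (.inl i), fun i => hu _, fun j => ?_, ?_⟩
  · have := heval (Pi.single j 1) 0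
    simp only [Fintype.sum_sum_type, ha1, ha2, ha3] at this
    have h2 : ∑ x, u (.inr (.inl x)) * -(Pi.single j 1 : Fin n → ℝ) x = -u (.inr (.inl j)) := by
      rw [Finset.sum_eq_single j] <;> simp +contextual
    rw [h2] at this
    simp only [mulVec_single_one, Matrix.col_apply, mul_zero, zero_sub, mul_neg,
      Finset.sum_neg_distrib, neg_zero, Finset.sum_const_zero, add_zero] at this
    have h3 := hu (.inr (.inl j))
    simp only [vecMul, dotProduct, Pi.zero_apply]
    linarith
  · have := heval 0 1
    simp only [Fintype.sum_sum_type, ha1, ha2, ha3] at this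
    have h3 := hu (.inr (.inr ()))
    simp only [mul_one, mulVec_zero, Pi.zero_apply, sub_zero, neg_zero, mul_zero,
      Finset.sum_const_zero, Finset.univ_unique, Finset.sum_singleton, zero_add, mul_neg] at this
    simp only [dotProduct]
    change 0 < ∑ i, u (.inl i) * b i
    linarith

/-- Approximate strong duality: below the value of a feasible linear program there are dual
feasible solutions. -/
theorem exists_dual_feasible_gt (q : Fin n → ℝ) {v : ℝ} (hfeas : ∃ y, 0 ≤ y ∧ b ≤ A *ᵥ y)
    (hv : ∀ y, 0 ≤ y → b ≤ A *ᵥ y → v < q ⬝ᵥ y) :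
    ∃ u : ι → ℝ, 0 ≤ u ∧ u ᵥ* A ≤ q ∧ v < u ⬝ᵥ b := by
  -- The additional row says `q ⬝ᵥ y ≤ v`, which makes the system infeasible. Its multiplier `μ` is
  -- positive, because `μ = 0` would certify infeasibility of the original system. Dividing by `μ`
  -- gives the dual solution.
  let A' : Matrix (ι ⊕ Unit) (Fin n) ℝ := Matrix.of (Sum.elim A fun _ => -q)
  let b' : ι ⊕ Unit → ℝ := Sum.elim b fun _ => -v
  obtain ⟨u, hu, huA, hub⟩ := exists_dual_ray_of_infeasible A' b' (by
    intro y hy hb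
    have h1 := hv y hy fun i => hb (.inl i)
    have h2 : -v ≤ -q ⬝ᵥ y := hb (.inr ())
    rw [neg_dotProduct] at h2
    linarith)
  set u₁ : ι → ℝ := fun i => u (.inl i) with hu₁
  set μ := u (.inr ()) with hμ
  have hμ0 : 0 ≤ μ := hu _
  have hu₁0 : 0 ≤ u₁ := fun i => hu _
  have h1 : u₁ ᵥ* A ≤ μ • q := by
    intro j
    have := huA j
    rw [vecMul, dotProduct, Fintype.sum_sum_type, Fintype.sum_unique (ι := Unit)] at this
    change (u₁ ᵥ* A) j + μ * -q j ≤ 0 at this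
    rw [Pi.smul_apply, smul_eq_mul]
    linarith
  have h2 : μ * v < u₁ ⬝ᵥ b := by
    rw [dotProduct, Fintype.sum_sum_type, Fintype.sum_unique (ι := Unit)] at hub
    change 0 < u₁ ⬝ᵥ b + μ * -v at hub
    linarith
  rcases hμ0.eq_or_lt with h0 | hpos
  · exfalso
    obtain ⟨y, hy, hb⟩ := hfeas
    rw [← h0, zero_smul] at h1
    rw [← h0, zero_mul] at h2
    have h3 : u₁ ⬝ᵥ b ≤ u₁ ⬝ᵥ (A *ᵥ y) := dotProduct_le_dotProduct_of_nonneg_left hb hu₁0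
    have h4 : (u₁ ᵥ* A) ⬝ᵥ y ≤ 0 ⬝ᵥ y := dotProduct_le_dotProduct_of_nonneg_right h1 hy
    rw [dotProduct_mulVec] at h3
    rw [zero_dotProduct] at h4
    linarith
  · refine ⟨μ⁻¹ • u₁, smul_nonneg (inv_nonneg.2 hμ0) hu₁0, ?_, ?_⟩
    · rw [smul_vecMul]
      have := smul_le_smul_of_nonneg_left h1 (inv_nonneg.2 hμ0)
      rwa [inv_smul_smul₀ hpos.ne'] at this
    · rw [smul_dotProduct, smul_eq_mul, inv_mul_eq_div, lt_div_iff₀ hpos]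
      linarith

end LinearProgramming

namespace TwoStageICO

variable {n₁ n₂ m τ d r k : ℕ} (I : TwoStageICO n₁ n₂ m τ d r k)

/-! ### Subproblems and their duals -/

section Subproblem

variable {L : ℕ} (c : Fin L → Fin d → ℝ) (s : Fin m) (x : Fin n₁ → ℝ) (w : Fin τ → Fin L → ℝ)

/-- The left-hand side of the dual constraints as a linear map. -/
def dualLhsLin : ((Fin r → ℝ) × (Fin τ → Fin L → ℝ)) →ₗ[ℝ] (Fin n₂ → ℝ) where
  toFun := I.dualLhs c s
  map_add' g g' := by
    simp only [dualLhs, Prod.fst_add, Prod.snd_add, mulVec_add, Pi.add_apply, add_smul,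
      Finset.sum_add_distrib]
    abel
  map_smul' a g := by
    simp only [dualLhs, Prod.smul_fst, Prod.smul_snd, mulVec_smul, Pi.smul_apply, smul_sub,
      Finset.smul_sum, smul_assoc, RingHom.id_apply]

/-- The dual objective as a linear map. -/
def dualObjLin : ((Fin r → ℝ) × (Fin τ → Fin L → ℝ)) →ₗ[ℝ] ℝ where
  toFun := I.dualObj c s x w
  map_add' g g' := by
    simp only [dualObj, Prod.fst_add, Prod.snd_add, add_dotProduct, Pi.add_apply, add_mul,
      Finset.sum_add_distrib]
    ring
  map_smul' a g := by
    simp only [dualObj, Prod.smul_fst, Prod.smul_snd, smul_dotProduct, Pi.smul_apply, smul_eq_mul,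
      mul_add, Finset.mul_sum, mul_assoc, RingHom.id_apply]

lemma dualLhs_smul (a : ℝ) (g : (Fin r → ℝ) × (Fin τ → Fin L → ℝ)) :
    I.dualLhs c s (a • g) = a • I.dualLhs c s g := (I.dualLhsLin c s).map_smul a g

lemma dualLhs_add (g g' : (Fin r → ℝ) × (Fin τ → Fin L → ℝ)) :
    I.dualLhs c s (g + g') = I.dualLhs c s g + I.dualLhs c s g' := (I.dualLhsLin c s).map_add g g'

lemma dualObj_smul (a : ℝ) (g : (Fin r → ℝ) × (Fin τ → Fin L → ℝ)) :
    I.dualObj c s x w (a • g) = a * I.dualObj c s x w g := (I.dualObjLin c s x w).map_smul a g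

lemma dualLhs_dotProduct (g : (Fin r → ℝ) × (Fin τ → Fin L → ℝ)) (y : Fin n₂ → ℝ) :
    I.dualLhs c s g ⬝ᵥ y =
      g.1 ⬝ᵥ (I.Wm s *ᵥ y) + ∑ t, ∑ l, g.2 t l * -(c l ⬝ᵥ (I.gtil s *ᵥ y)) := by
  simp only [dualLhs, sub_dotProduct, sum_dotProduct, smul_dotProduct, mulVec_transpose,
    ← dotProduct_mulVec, smul_eq_mul, mul_neg, Finset.sum_neg_distrib]
  rw [sub_eq_add_neg]

variable {I c s x w}

/-- The half of weak duality that uses only the signs of the multipliers, so it serves optimality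
cuts and feasibility cuts alike. -/
lemma dualObj_le_dualLhs_dotProduct {g : (Fin r → ℝ) × (Fin τ → Fin L → ℝ)} (hg : 0 ≤ g)
    {y : Fin n₂ → ℝ} (hy : y ∈ I.SubFeas c s x w) :
    I.dualObj c s x w g ≤ I.dualLhs c s g ⬝ᵥ y := by
  rw [dualLhs_dotProduct, dualObj]
  refine add_le_add (dotProduct_le_dotProduct_of_nonneg_left hy.2.1 hg.1) ?_
  exact Finset.sum_le_sum fun t _ => Finset.sum_le_sum fun l _ =>
    mul_le_mul_of_nonneg_left (hy.2.2 t l) (hg.2 t l)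

/-- Weak duality. -/
lemma dualObj_le_of_mem_dualFeas {g : (Fin r → ℝ) × (Fin τ → Fin L → ℝ)}
    (hg : g ∈ I.DualFeas c s) {y : Fin n₂ → ℝ} (hy : y ∈ I.SubFeas c s x w) :
    I.dualObj c s x w g ≤ I.q s ⬝ᵥ y :=
  (dualObj_le_dualLhs_dotProduct hg.1 hy).trans
    (dotProduct_le_dotProduct_of_nonneg_right hg.2 hy.1)

lemma dualObj_nonpos_of_mem_dualCone {g : (Fin r → ℝ) × (Fin τ → Fin L → ℝ)}
    (hg : g ∈ I.DualCone c s) {y : Fin n₂ → ℝ} (hy : y ∈ I.SubFeas c s x w) :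
    I.dualObj c s x w g ≤ 0 := by
  have := dotProduct_le_dotProduct_of_nonneg_right hg.2 hy.1
  rw [zero_dotProduct] at this
  exact (dualObj_le_dualLhs_dotProduct hg.1 hy).trans this

variable (I c s x w)

/-- Constraint matrix of the subproblem. -/
def subMatrix : Matrix (Fin r ⊕ Fin τ × Fin L) (Fin n₂) ℝ :=
  Matrix.of (Sum.elim (I.Wm s) fun p => -((I.gtil s)ᵀ *ᵥ c p.2))

/-- Right-hand side of the subproblem. -/
def subRhs : Fin r ⊕ Fin τ × Fin L → ℝ :=
  Sum.elim (I.h s - I.Tm s *ᵥ x)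
    fun p => c p.2 ⬝ᵥ (I.gbar s *ᵥ x) - c p.2 ⬝ᵥ I.z p.1 - w p.1 p.2

lemma subMatrix_mulVec_inr (y : Fin n₂ → ℝ) (p : Fin τ × Fin L) :
    (I.subMatrix c s *ᵥ y) (.inr p) = -(c p.2 ⬝ᵥ (I.gtil s *ᵥ y)) := by
  change -((I.gtil s)ᵀ *ᵥ c p.2) ⬝ᵥ y = _
  rw [neg_dotProduct, mulVec_transpose, dotProduct_mulVec]

lemma mem_subFeas_iff (y : Fin n₂ → ℝ) :
    y ∈ I.SubFeas c s x w ↔ 0 ≤ y ∧ I.subRhs c s x w ≤ I.subMatrix c s *ᵥ y := by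
  refine and_congr_right fun _ => ⟨fun h => ?_, fun h => ⟨fun i => h (.inl i), fun t l => ?_⟩⟩
  · rintro (i | p)
    · exact h.1 i
    · rw [subMatrix_mulVec_inr]
      exact h.2 p.1 p.2
  · have := h (.inr (t, l))
    rwa [subMatrix_mulVec_inr] at this

lemma dualLhs_eq_vecMul (u : Fin r ⊕ Fin τ × Fin L → ℝ) :
    I.dualLhs c s (fun i => u (.inl i), fun t l => u (.inr (t, l))) = u ᵥ* I.subMatrix c s := by
  funext j
  simp only [dualLhs, Pi.sub_apply, mulVec_transpose, Finset.sum_apply, Pi.smul_apply,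
    smul_eq_mul]
  have h1 : ∀ i, I.subMatrix c s (.inl i) j = I.Wm s i j := fun _ => rfl
  have h2 : ∀ t l, I.subMatrix c s (.inr (t, l)) j = -(c l ᵥ* I.gtil s) j := fun t l => by
    rw [← mulVec_transpose]
    rfl
  rw [vecMul, vecMul, dotProduct, dotProduct, Fintype.sum_sum_type, Fintype.sum_prod_type]
  simp only [h1, h2, mul_neg, Finset.sum_neg_distrib]
  rw [sub_eq_add_neg]

lemma dualObj_eq_dotProduct (u : Fin r ⊕ Fin τ × Fin L → ℝ) :
    I.dualObj c s x w (fun i => u (.inl i), fun t l => u (.inr (t, l))) =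
      u ⬝ᵥ I.subRhs c s x w := by
  simp only [dualObj, dotProduct, Fintype.sum_sum_type, Fintype.sum_prod_type, subRhs,
    Sum.elim_inl, Sum.elim_inr]

lemma isPolyhedron_nonneg_multiplier :
    IsPolyhedron {g : (Fin r → ℝ) × (Fin τ → Fin L → ℝ) | 0 ≤ g} := by
  refine IsPolyhedron.setOf_and
    (p := fun g : (Fin r → ℝ) × (Fin τ → Fin L → ℝ) => ∀ i, 0 ≤ g.1 i)
    (q := fun g : (Fin r → ℝ) × (Fin τ → Fin L → ℝ) => ∀ t l, 0 ≤ g.2 t l) ?_ ?_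
  · exact IsPolyhedron.setOf_forall fun i => isPolyhedron_ge
      (LinearMap.proj i ∘ₗ LinearMap.fst ℝ (Fin r → ℝ) (Fin τ → Fin L → ℝ)) 0
  · exact IsPolyhedron.setOf_forall fun t => IsPolyhedron.setOf_forall fun l => isPolyhedron_ge
      (LinearMap.proj l ∘ₗ LinearMap.proj t ∘ₗ
        LinearMap.snd ℝ (Fin r → ℝ) (Fin τ → Fin L → ℝ)) 0

/-- The bound `v` is free so that `q s` gives the dual feasible set and `0` its recession cone. -/
lemma isPolyhedron_dualLhs_le (v : Fin n₂ → ℝ) :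
    IsPolyhedron {g | 0 ≤ g ∧ I.dualLhs c s g ≤ v} := by
  refine isPolyhedron_nonneg_multiplier.setOf_and ?_
  exact IsPolyhedron.setOf_forall fun j =>
    isPolyhedron_le (LinearMap.proj j ∘ₗ I.dualLhsLin c s) (v j)

lemma isPolyhedron_dualFeas : IsPolyhedron (I.DualFeas c s) := I.isPolyhedron_dualLhs_le c s _

lemma isPolyhedron_dualCone : IsPolyhedron (I.DualCone c s) := I.isPolyhedron_dualLhs_le c s _

lemma multiplier_eq_zero_of_line {g v : (Fin r → ℝ) × (Fin τ → Fin L → ℝ)}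
    (h : ∀ t : ℝ, 0 ≤ g + t • v) : v = 0 := by
  refine Prod.ext (eq_zero_of_forall_nonneg_add_smul (x := g.1) fun a i => (h a).1 i) ?_
  funext t
  exact eq_zero_of_forall_nonneg_add_smul (x := g.2 t) fun a l => (h a).2 t l

lemma isPolyhedron_subFeas : IsPolyhedron (I.SubFeas c s x w) := by
  have : I.SubFeas c s x w =
      {y | (∀ j, 0 ≤ y j) ∧ ∀ i, I.subRhs c s x w i ≤ (I.subMatrix c s).mulVecLin y i} :=
    Set.ext (I.mem_subFeas_iff c s x w)
  rw [this]
  refine IsPolyhedron.setOf_and ?_ ?_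
  · exact IsPolyhedron.setOf_forall fun j =>
      isPolyhedron_ge (LinearMap.proj (R := ℝ) (φ := fun _ : Fin n₂ => ℝ) j) 0
  · exact IsPolyhedron.setOf_forall fun i =>
      isPolyhedron_ge (LinearMap.proj i ∘ₗ (I.subMatrix c s).mulVecLin) _

variable {I c s x w}

lemma subFeas_subset_Y : I.SubFeas c s x w ⊆ I.Y s x :=
  fun _ hy => ⟨hy.1, sub_le_iff_le_add'.1 hy.2.1⟩

/-- A feasible subproblem has an optimal solution. -/
lemma exists_subOptimal (hx : x ∈ I.X) (hne : (I.SubFeas c s x w).Nonempty) :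
    ∃ y, I.SubOptimal c s x w y := by
  obtain ⟨M, hM⟩ := I.recourse_bdd x hx.1 hx.2.1 hx.2.2 s
  have hpoly := I.isPolyhedron_subFeas c s x w
  obtain ⟨y, hy, hmin⟩ := hpoly.exists_extremePoint_isMin (φ := fun y => I.q s ⬝ᵥ y) (M := M)
    (fun y v h => eq_zero_of_forall_nonneg_add_smul (x := y) fun t i => (h t).1 i)
    ((dotProductBilin ℝ ℝ (I.q s)).concaveOn hpoly.convex)
    (fun y hy => hM ⟨y, subFeas_subset_Y hy, rfl⟩) hne
  exact ⟨y, hy.1, hmin⟩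

/-- Strong duality up to an arbitrarily small gap. Attainment is supplied separately, by the vertex
principle on the dual polyhedron. -/
lemma exists_mem_dualFeas_gt (hne : (I.SubFeas c s x w).Nonempty) {v : ℝ}
    (hv : ∀ y ∈ I.SubFeas c s x w, v < I.q s ⬝ᵥ y) :
    ∃ g ∈ I.DualFeas c s, v < I.dualObj c s x w g := by
  simp only [mem_subFeas_iff] at hv
  obtain ⟨y, hy⟩ := hne
  obtain ⟨u, hu, huA, hub⟩ := exists_dual_feasible_gt (I.subMatrix c s) (I.subRhs c s x w) (I.q s)
    ⟨y, (I.mem_subFeas_iff c s x w y).1 hy⟩ fun y h1 h2 => hv y ⟨h1, h2⟩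
  refine ⟨(fun i => u (.inl i), fun t l => u (.inr (t, l))),
    ⟨⟨fun i => hu _, fun t l => hu _⟩, ?_⟩, ?_⟩
  · rwa [dualLhs_eq_vecMul]
  · rwa [dualObj_eq_dotProduct]

/-- The dual of a subproblem with an optimal solution has an optimal vertex. -/
lemma exists_dual_optimal_vertex {y : Fin n₂ → ℝ} (hy : I.SubOptimal c s x w y) :
    ∃ g ∈ Set.extremePoints ℝ (I.DualFeas c s),
      ∀ g' ∈ I.DualFeas c s, I.dualObj c s x w g' ≤ I.dualObj c s x w g := by
  have hpoly := I.isPolyhedron_dualFeas c s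
  -- Any level below the optimal value would do; only a dual feasible point is needed.
  obtain ⟨g₀, hg₀, -⟩ := exists_mem_dualFeas_gt ⟨y, hy.1⟩ (v := I.q s ⬝ᵥ y - 1)
    fun y' hy' => by linarith [hy.2 y' hy']
  obtain ⟨g, hg, hmin⟩ := hpoly.exists_extremePoint_isMin (φ := (-I.dualObjLin c s x w))
    (M := -(I.q s ⬝ᵥ y)) (fun g v h => multiplier_eq_zero_of_line fun t => (h t).1)
    ((-I.dualObjLin c s x w).concaveOn hpoly.convex)
    (fun g hg => neg_le_neg (dualObj_le_of_mem_dualFeas hg hy.1)) ⟨g₀, hg₀⟩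
  exact ⟨g, hg, fun g' hg' => neg_le_neg_iff.1 (hmin g' hg')⟩

/-- Strong duality. -/
lemma SubOptimal.le_dualObj {y : Fin n₂ → ℝ} (hy : I.SubOptimal c s x w y)
    {g : (Fin r → ℝ) × (Fin τ → Fin L → ℝ)}
    (hg : ∀ g' ∈ I.DualFeas c s, I.dualObj c s x w g' ≤ I.dualObj c s x w g) :
    I.q s ⬝ᵥ y ≤ I.dualObj c s x w g := by
  refine le_of_forall_lt fun v hv => ?_
  obtain ⟨g', hg', hlt⟩ := exists_mem_dualFeas_gt ⟨y, hy.1⟩ fun y' hy' => hv.trans_le (hy.2 y' hy')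
  exact hlt.trans_le (hg g' hg')

lemma smul_mem_dualCone {g : (Fin r → ℝ) × (Fin τ → Fin L → ℝ)} (hg : g ∈ I.DualCone c s) {a : ℝ}
    (ha : 0 ≤ a) : a • g ∈ I.DualCone c s := by
  refine ⟨smul_nonneg ha hg.1, ?_⟩
  rw [dualLhs_smul]
  exact smul_nonpos_of_nonneg_of_nonpos ha hg.2

lemma add_mem_dualCone {g g' : (Fin r → ℝ) × (Fin τ → Fin L → ℝ)} (hg : g ∈ I.DualCone c s)
    (hg' : g' ∈ I.DualCone c s) : g + g' ∈ I.DualCone c s := by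
  refine ⟨add_nonneg hg.1 hg'.1, ?_⟩
  rw [dualLhs_add]
  exact add_nonpos hg.2 hg'.2

/-- An infeasible subproblem has an extreme dual ray along which the dual objective increases. -/
lemma exists_extremeRay_of_subFeas_eq_empty (h : I.SubFeas c s x w = ∅) :
    ∃ g, IsExtremeRay (I.DualCone c s) g ∧ 0 < I.dualObj c s x w g := by
  obtain ⟨u, hu, huA, hub⟩ := exists_dual_ray_of_infeasible (I.subMatrix c s) (I.subRhs c s x w)
    fun y hy hb => Set.eq_empty_iff_forall_notMem.1 h y ((I.mem_subFeas_iff c s x w y).2 ⟨hy, hb⟩)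
  exact exists_extremeRay_pos (D := I.dualObjLin c s x w) (I.isPolyhedron_dualCone c s)
    (fun g hg a ha => smul_mem_dualCone hg ha) (fun g hg g' hg' => add_mem_dualCone hg hg')
    (fun g v h => multiplier_eq_zero_of_line fun t => (h t).1)
    (g := (fun i => u (.inl i), fun t l => u (.inr (t, l))))
    ⟨⟨fun i => hu _, fun t l => hu _⟩, by rwa [dualLhs_eq_vecMul]⟩
    (hub.trans_eq (I.dualObj_eq_dotProduct c s x w u).symm)

variable (I c s) in
/-- Up to scaling, the dual cone has finitely many extreme rays. -/
lemma exists_finite_dual_extremeRays :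
    ∃ R : Set ((Fin r → ℝ) × (Fin τ → Fin L → ℝ)), R.Finite ∧
      ∀ g, IsExtremeRay (I.DualCone c s) g → ∃ α : ℝ, 0 < α ∧ ∃ e ∈ R, g = α • e := by
  -- The sum of all components is positive on nonzero nonnegative multipliers, so it normalizes
  -- rays.
  let ℓ : ((Fin r → ℝ) × (Fin τ → Fin L → ℝ)) →ₗ[ℝ] ℝ :=
    (∑ i, LinearMap.proj i) ∘ₗ LinearMap.fst ℝ _ _ +
      (∑ t, ∑ l, LinearMap.proj l ∘ₗ LinearMap.proj t) ∘ₗ LinearMap.snd ℝ _ _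
  have hℓ : ∀ g, ℓ g = ∑ i, g.1 i + ∑ t, ∑ l, g.2 t l := fun g => by simp [ℓ]
  refine exists_finite_extremeRays (I.isPolyhedron_dualCone c s)
    (fun g hg a ha => smul_mem_dualCone hg ha) (ℓ := ℓ) fun g hg hne => ?_
  have h1 : 0 ≤ ∑ i, g.1 i := Finset.sum_nonneg fun i _ => hg.1.1 i
  have h2 : ∀ t, 0 ≤ ∑ l, g.2 t l := fun t => Finset.sum_nonneg fun l _ => hg.1.2 t l
  have h3 : 0 ≤ ∑ t, ∑ l, g.2 t l := Finset.sum_nonneg fun t _ => h2 t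
  rw [hℓ]
  refine lt_of_le_of_ne (add_nonneg h1 h3) fun h => hne ?_
  have h4 : ∑ i, g.1 i = 0 := by linarith
  have h5 : ∑ t, ∑ l, g.2 t l = 0 := by linarith
  rw [Finset.sum_eq_zero_iff_of_nonneg fun i _ => hg.1.1 i] at h4
  rw [Finset.sum_eq_zero_iff_of_nonneg fun t _ => h2 t] at h5
  refine Prod.ext (funext fun i => h4 i (Finset.mem_univ _)) (funext fun t => funext fun l => ?_)
  have h6 := h5 t (Finset.mem_univ _)
  rw [Finset.sum_eq_zero_iff_of_nonneg fun l _ => hg.1.2 t l] at h6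
  exact h6 l (Finset.mem_univ _)

end Subproblem

/-! ### Separation problems -/

section Separation

variable (t : Fin τ)

lemma isPolyhedron_C : IsPolyhedron I.C := by
  refine IsPolyhedron.setOf_and (p := fun c => c ∈ stdSimplex ℝ (Fin d))
    (q := fun c => I.A *ᵥ c ≤ I.b) ?_ ?_
  · refine IsPolyhedron.setOf_and (p := fun c : Fin d → ℝ => ∀ i, 0 ≤ c i)
      (q := fun c => ∑ i, c i = 1) ?_ ?_
    · exact IsPolyhedron.setOf_forall fun j =>
        isPolyhedron_ge (LinearMap.proj (R := ℝ) (φ := fun _ : Fin d => ℝ) j) 0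
    · simpa using isPolyhedron_eq (∑ j, LinearMap.proj (R := ℝ) (φ := fun _ : Fin d => ℝ) j) 1
  · exact IsPolyhedron.setOf_forall fun i => isPolyhedron_le (LinearMap.proj i ∘ₗ I.A.mulVecLin) _

lemma isPolyhedron_P : IsPolyhedron (I.P t) := by
  refine IsPolyhedron.setOf_and (p := fun cw : (Fin d → ℝ) × (Fin τ → ℝ) => cw.1 ∈ I.C) ?_
    (IsPolyhedron.setOf_and ?_ ?_)
  · exact I.isPolyhedron_C.preimage (LinearMap.fst ℝ (Fin d → ℝ) (Fin τ → ℝ))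
  · exact IsPolyhedron.setOf_forall fun i =>
      isPolyhedron_ge (LinearMap.proj i ∘ₗ LinearMap.snd ℝ (Fin d → ℝ) (Fin τ → ℝ)) 0
  · refine IsPolyhedron.setOf_forall fun i => ?_
    have := isPolyhedron_le
      (dotProductBilin ℝ ℝ (I.z i - I.z t) ∘ₗ LinearMap.fst ℝ (Fin d → ℝ) (Fin τ → ℝ) -
        LinearMap.proj i ∘ₗ LinearMap.snd ℝ (Fin d → ℝ) (Fin τ → ℝ)) 0
    convert this using 2
    ext cw
    simp [dotProduct_comm cw.1]

lemma finite_vertexScal : I.vertexScal.Finite :=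
  Set.finite_iUnion fun t => (I.isPolyhedron_P t).finite_extremePoints.image _

variable {I} in
lemma vertexProj_subset_C : I.vertexProj t ⊆ I.C := by
  rintro _ ⟨cw, hcw, rfl⟩
  exact hcw.1.1

variable {I} in
lemma mem_C_of_mem_vertexScal {c : Fin d → ℝ} (hc : c ∈ I.vertexScal) : c ∈ I.C := by
  obtain ⟨t, ht⟩ := Set.mem_iUnion.1 hc
  exact vertexProj_subset_C t ht

/-- The expected excess of the outcome is a convex function of the scalarization vector. -/
lemma convexOn_sum_excess (x : Fin n₁ → ℝ) (y : Fin m → Fin n₂ → ℝ) :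
    ConvexOn ℝ Set.univ fun c => ∑ s, I.p s * I.excess x y s t c := by
  refine ⟨convex_univ, fun c _ c' _ a b ha hb _ => ?_⟩
  simp only [smul_eq_mul, Finset.mul_sum, ← Finset.sum_add_distrib]
  refine Finset.sum_le_sum fun s _ => ?_
  have h : I.excess x y s t (a • c + b • c') ≤ a * I.excess x y s t c + b * I.excess x y s t c' := by
    simp only [excess, add_dotProduct, smul_dotProduct, smul_eq_mul]
    have h1 := mul_le_mul_of_nonneg_left
      (le_max_left (c ⬝ᵥ I.outcome s x (y s) - c ⬝ᵥ I.z t) 0) ha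
    have h2 := mul_le_mul_of_nonneg_left
      (le_max_left (c' ⬝ᵥ I.outcome s x (y s) - c' ⬝ᵥ I.z t) 0) hb
    have h3 := mul_nonneg ha (le_max_right (c ⬝ᵥ I.outcome s x (y s) - c ⬝ᵥ I.z t) 0)
    have h4 := mul_nonneg hb (le_max_right (c' ⬝ᵥ I.outcome s x (y s) - c' ⬝ᵥ I.z t) 0)
    exact max_le (by linarith) (by linarith)
  have := mul_le_mul_of_nonneg_left h (I.p_nonneg s)
  linarith

/-- The coordinates of `c` lie in `[0, 1]`, so the bound is uniform in `c`. It supplies the lower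
bound that the vertex principle requires for the separation objective. -/
lemma excess_le (x : Fin n₁ → ℝ) (y : Fin m → Fin n₂ → ℝ) (s : Fin m) {c : Fin d → ℝ}
    (hc : c ∈ I.C) : I.excess x y s t c ≤ ∑ i, |I.outcome s x (y s) i - I.z t i| := by
  refine max_le ?_ (Finset.sum_nonneg fun i _ => abs_nonneg _)
  rw [← dotProduct_sub]
  refine Finset.sum_le_sum fun i _ => ?_
  have h0 : 0 ≤ c i := hc.1.1 i
  have h1 : c i ≤ 1 := hc.1.2 ▸ Finset.single_le_sum (fun j _ => hc.1.1 j) (Finset.mem_univ i)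
  calc c i * (I.outcome s x (y s) - I.z t) i ≤ c i * |(I.outcome s x (y s) - I.z t) i| :=
        mul_le_mul_of_nonneg_left (le_abs_self _) h0
    _ ≤ 1 * |(I.outcome s x (y s) - I.z t) i| := mul_le_mul_of_nonneg_right h1 (abs_nonneg _)
    _ = _ := one_mul _

/-- The separation problems have optimal solutions that are projections of vertices. -/
lemma exists_sepVertexOptimal (x : Fin n₁ → ℝ) (y : Fin m → Fin n₂ → ℝ) :
    ∃ c, I.SepVertexOptimal x y t c := by
  let tight : (Fin d → ℝ) → Fin τ → ℝ := fun c i => max (c ⬝ᵥ I.z i - c ⬝ᵥ I.z t) 0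
  have htight : ∀ c ∈ I.C, (c, tight c) ∈ I.P t := fun c hc =>
    ⟨hc, fun i => le_max_right _ _, fun i => le_max_left _ _⟩
  let lin : ((Fin d → ℝ) × (Fin τ → ℝ)) →ₗ[ℝ] ℝ :=
    dotProductBilin ℝ ℝ I.ptil ∘ₗ LinearMap.snd ℝ (Fin d → ℝ) (Fin τ → ℝ)
  -- Linear in `w` minus convex in `c`, hence concave. It equals the separation objective at `(c,
  -- tight c)` and is at least as large elsewhere on `P t`.
  let φ : (Fin d → ℝ) × (Fin τ → ℝ) → ℝ := fun cw =>
    lin cw - ∑ s, I.p s * I.excess x y s t cw.1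
  have hpoly := I.isPolyhedron_P t
  have hconc : ConcaveOn ℝ (I.P t) φ := (lin.concaveOn hpoly.convex).sub
    (((I.convexOn_sum_excess t x y).comp_linearMap (LinearMap.fst ℝ (Fin d → ℝ) (Fin τ → ℝ))).subset
      (Set.subset_univ _) hpoly.convex)
  have hbdd : ∀ cw ∈ I.P t,
      -∑ s, I.p s * ∑ i, |I.outcome s x (y s) i - I.z t i| ≤ φ cw := by
    intro cw hcw
    have h1 : 0 ≤ lin cw := dotProduct_nonneg_of_nonneg I.ptil_nonneg hcw.2.1
    have h2 : ∑ s, I.p s * I.excess x y s t cw.1 ≤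
        ∑ s, I.p s * ∑ i, |I.outcome s x (y s) i - I.z t i| :=
      Finset.sum_le_sum fun s _ =>
        mul_le_mul_of_nonneg_left (I.excess_le t x y s hcw.1) (I.p_nonneg s)
    change _ ≤ lin cw - _
    linarith
  obtain ⟨c₀, hc₀⟩ := I.nonempty_C
  obtain ⟨e, he, hmin⟩ := hpoly.exists_extremePoint_isMin (fun cw v h => Prod.ext
    (eq_zero_of_forall_nonneg_add_smul (x := cw.1) fun a i => (h a).1.1.1 i)
    (eq_zero_of_forall_nonneg_add_smul (x := cw.2) fun a i => (h a).2.1 i)) hconc hbdd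
    ⟨_, htight c₀ hc₀⟩
  refine ⟨e.1, he.1.1, fun c hc => ?_, e, he, rfl⟩
  refine le_trans ?_ (hmin _ (htight c hc))
  refine sub_le_sub_right (Finset.sum_le_sum fun i _ => ?_) _
  exact mul_le_mul_of_nonneg_left (max_le (he.1.2.2 i) (he.1.2.1 i)) (I.ptil_nonneg i)

end Separation

end TwoStageICO

/-! ### Stabilization of increasing sequences in finite sets -/

/-- An increasing sequence of subsets of a finite set is eventually constant. -/
lemma exists_forall_ge_eq_of_monotone {α : Type*} {U : Set α} (hU : U.Finite) {S : ℕ → Set α}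
    (hS : Monotone S) (hSU : ∀ j, S j ⊆ U) : ∃ N, ∀ j ≥ N, S j = S N := by
  have hfin : (Set.range S).Finite :=
    hU.finite_subsets.subset (Set.range_subset_iff.2 hSU)
  obtain ⟨_, ⟨N, rfl⟩, hN⟩ := hfin.exists_maximal ⟨S 0, 0, rfl⟩
  exact ⟨N, fun j hj => (hN ⟨j, rfl⟩ (hS hj)).antisymm (hS hj)⟩

lemma Set.Finite.setOf_snd_mem {ι α : Type*} [Finite ι] {U : ι → Set α} (hU : ∀ i, (U i).Finite) :
    {p : ι × α | p.2 ∈ U p.1}.Finite := by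
  refine (Set.finite_iUnion fun i => (hU i).image (Prod.mk i)).subset ?_
  rintro ⟨i, a⟩ h
  exact Set.mem_iUnion.2 ⟨i, a, h, rfl⟩

namespace TwoStageICO

variable {n₁ n₂ m τ d r k : ℕ} {I : TwoStageICO n₁ n₂ m τ d r k}

/-! ### Feasibility for all scalarization vectors -/

variable (I) in
/-- Feasibility in the model with the ICO constraint for all scalarization vectors of `C`. -/
def ICOFeasible (x : Fin n₁ → ℝ) (y : Fin m → Fin n₂ → ℝ) : Prop :=
  x ∈ I.X ∧ (∀ s, y s ∈ I.Y s x) ∧ ∀ t, ∀ c ∈ I.C, 0 ≤ I.sepObj x y t c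

lemma ICOFeasible.defFeasible {x : Fin n₁ → ℝ} {y : Fin m → Fin n₂ → ℝ} (h : I.ICOFeasible x y) :
    I.DEFFeasible x (fun s t c => I.excess x y s t c) y :=
  ⟨h.1, h.2.1, fun t c => sub_nonneg.1 (h.2.2 t c (mem_C_of_mem_vertexScal c.2)),
    fun _ _ _ => le_max_left _ _, fun _ _ _ => le_max_right _ _⟩

/-- For each `t` the separation objective is smallest at some projected vertex, where the finitely
many constraints already make it nonnegative. -/
lemma DEFFeasible.icoFeasible {x : Fin n₁ → ℝ} {w : Fin m → Fin τ → I.vertexScal → ℝ}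
    {y : Fin m → Fin n₂ → ℝ} (h : I.DEFFeasible x w y) : I.ICOFeasible x y := by
  refine ⟨h.1, h.2.1, fun t c hc => ?_⟩
  obtain ⟨c', -, hmin, hc'⟩ := I.exists_sepVertexOptimal t x y
  refine le_trans (sub_nonneg.2 ?_) (hmin c hc)
  have hv : c' ∈ I.vertexScal := Set.mem_iUnion.2 ⟨t, hc'⟩
  refine le_trans (Finset.sum_le_sum fun s _ => ?_) (h.2.2.1 t ⟨c', hv⟩)
  exact mul_le_mul_of_nonneg_left (max_le (h.2.2.2.1 s t ⟨c', hv⟩) (h.2.2.2.2 s t ⟨c', hv⟩))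
    (I.p_nonneg s)

/-! ### Cuts -/

/-- The multipliers of a cut for the first `L` scalarization vectors. -/
def Cut.mult (L : ℕ) (e : Cut m τ r) : (Fin r → ℝ) × (Fin τ → Fin L → ℝ) :=
  (e.γ, fun t l => e.β t l)

/-- The multipliers of a cut vanish for all but the first `L` scalarization vectors. -/
def Cut.SupportedBelow (L : ℕ) (e : Cut m τ r) : Prop := ∀ t l, L ≤ l → e.β t l = 0

lemma mult_mkCut {L : ℕ} (s : Fin m) (g : (Fin r → ℝ) × (Fin τ → Fin L → ℝ)) :
    (mkCut s g).mult L = g :=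
  Prod.ext rfl (funext fun t => funext fun l => by simp [Cut.mult, mkCut])

lemma supportedBelow_mkCut {L : ℕ} (s : Fin m) (g : (Fin r → ℝ) × (Fin τ → Fin L → ℝ)) :
    (mkCut s g).SupportedBelow L := fun t l hl => by simp [mkCut, hl.not_gt]

lemma cutRhs_mkCut {L : ℕ} (c : Fin L → Fin d → ℝ) (x : Fin n₁ → ℝ)
    (w : Fin m → Fin τ → Fin L → ℝ) (s : Fin m) (g : (Fin r → ℝ) × (Fin τ → Fin L → ℝ)) :
    I.cutRhs c x w (mkCut s g) = I.dualObj c s x (w s) g := by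
  change I.dualObj c s x (w s) ((mkCut s g).mult L) = _
  rw [mult_mkCut]

lemma Cut.SupportedBelow.succ {L : ℕ} {e : Cut m τ r} (h : e.SupportedBelow L) :
    e.SupportedBelow (L + 1) := fun t l hl => h t l (Nat.le_of_succ_le hl)

lemma Cut.SupportedBelow.nonneg_succ {L : ℕ} {e : Cut m τ r} (h : e.SupportedBelow L)
    (he : 0 ≤ e.mult L) : 0 ≤ e.mult (L + 1) := by
  refine ⟨he.1, fun t => Fin.lastCases ?_ fun l => ?_⟩
  · exact (h t L le_rfl).ge
  · exact he.2 t l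

/-- The new scalarization vector enters with multiplier zero, so old cuts keep their dual
feasibility after the vector is added. -/
lemma Cut.SupportedBelow.dualLhs_snoc {L : ℕ} {e : Cut m τ r} (h : e.SupportedBelow L)
    (c : Fin L → Fin d → ℝ) (c' : Fin d → ℝ) (s : Fin m) :
    I.dualLhs (Fin.snoc c c' : Fin (L + 1) → Fin d → ℝ) s (e.mult (L + 1)) =
      I.dualLhs c s (e.mult L) := by
  simp only [dualLhs, Cut.mult, Fin.sum_univ_castSucc, Fin.snoc_castSucc, Fin.snoc_last,
    Fin.val_castSucc, Fin.val_last, h _ _ le_rfl, zero_smul, add_zero]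

/-! ### Invariants -/

variable (I) in
/-- The properties of the memory that every iteration preserves. -/
structure Invariant (σ : State n₁ n₂ m τ d r) : Prop where
  c_mem : ∀ l, σ.c l ∈ I.C
  opt : ∀ e ∈ σ.optCuts, e.SupportedBelow σ.L ∧ e.mult σ.L ∈ I.DualFeas σ.c e.scen
  feas : ∀ e ∈ σ.feasCuts, e.SupportedBelow σ.L ∧ e.mult σ.L ∈ I.DualCone σ.c e.scen
  inc : ∀ x y, σ.inc = some (x, y) → I.ICOFeasible x y

lemma Start.invariant_init (P : I.Start) : I.Invariant P.init where
  c_mem := P.c_mem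
  opt _ he := he.elim
  feas _ he := he.elim
  inc _ _ h := by simp [Start.init] at h

lemma Invariant.snoc {L : ℕ} {c : Fin L → Fin d → ℝ} {O F : Set (Cut m τ r)}
    {inc : Option ((Fin n₁ → ℝ) × (Fin m → Fin n₂ → ℝ))} (h : I.Invariant ⟨L, c, O, F, inc⟩)
    {c' : Fin d → ℝ} (hc' : c' ∈ I.C) : I.Invariant ⟨L + 1, Fin.snoc c c', O, F, inc⟩ where
  c_mem := Fin.lastCases (by simpa using hc') fun l => by simpa using h.c_mem l
  opt e he := by
    obtain ⟨h1, h2, h3⟩ := h.opt e he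
    exact ⟨h1.succ, h1.nonneg_succ h2, (h1.dualLhs_snoc c c' e.scen).trans_le h3⟩
  feas e he := by
    obtain ⟨h1, h2, h3⟩ := h.feas e he
    exact ⟨h1.succ, h1.nonneg_succ h2, (h1.dualLhs_snoc c c' e.scen).trans_le h3⟩
  inc := h.inc

/-- Solutions of the subproblems whose separation problems have nonnegative values are feasible. -/
lemma icoFeasible_of_sepVertexOptimal {L : ℕ} {c : Fin L → Fin d → ℝ} {x : Fin n₁ → ℝ}
    {w : Fin m → Fin τ → Fin L → ℝ} {y : Fin m → Fin n₂ → ℝ} (hx : x ∈ I.X)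
    (hy : ∀ s, y s ∈ I.SubFeas c s x (w s)) {cst : Fin τ → Fin d → ℝ}
    (hcst : ∀ t, I.SepVertexOptimal x y t (cst t)) (hsep : ∀ t, 0 ≤ I.sepObj x y t (cst t)) :
    I.ICOFeasible x y :=
  ⟨hx, fun s => subFeas_subset_Y (hy s), fun t c hc => (hsep t).trans ((hcst t).2.1 c hc)⟩

lemma LoopBody.invariant {σ σ' : State n₁ n₂ m τ d r} {x : Fin n₁ → ℝ}
    {w : Fin m → Fin τ → Fin σ.L → ℝ} {θ : Fin m → ℝ} (h : I.LoopBody σ x w θ σ')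
    (hx : x ∈ I.X) (hσ : I.Invariant σ) : I.Invariant σ' := by
  obtain ⟨y, ray, pt, O, F, hray, hpt, hF, hO, hcase⟩ := h
  have hO' : ∀ e ∈ O, e.SupportedBelow σ.L ∧ e.mult σ.L ∈ I.DualFeas σ.c e.scen := by
    rw [hO]
    rintro e (he | ⟨s, hs, -, rfl⟩)
    · exact hσ.opt e he
    · refine ⟨supportedBelow_mkCut _ _, ?_⟩
      rw [mult_mkCut]
      exact (hpt s hs).2.1.1
  have hF' : ∀ e ∈ F, e.SupportedBelow σ.L ∧ e.mult σ.L ∈ I.DualCone σ.c e.scen := by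
    rw [hF]
    rintro e (he | ⟨s, hs, rfl⟩)
    · exact hσ.feas e he
    · refine ⟨supportedBelow_mkCut _ _, ?_⟩
      rw [mult_mkCut]
      exact (hray s hs).1.1
  have hmid : I.Invariant ⟨σ.L, σ.c, O, F, σ.inc⟩ := ⟨hσ.c_mem, hO', hF', hσ.inc⟩
  obtain ⟨-, rfl⟩ | ⟨hne, cst, hcst, ⟨hsep, rfl⟩ | ⟨t, -, rfl⟩⟩ := hcase
  · exact hmid
  · refine ⟨hσ.c_mem, hO', hF', fun x' y' hxy => ?_⟩
    obtain ⟨rfl, rfl⟩ := Prod.mk.inj (Option.some.inj hxy)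
    exact icoFeasible_of_sepVertexOptimal hx (fun s => (hpt s (hne s)).1.1) hcst hsep
  · exact hmid.snoc (hcst t).1

/-- The master problem is a relaxation of the model. -/
lemma Start.masterFeasible_of_icoFeasible (P : I.Start) {σ : State n₁ n₂ m τ d r}
    (hσ : I.Invariant σ) {x : Fin n₁ → ℝ} {y : Fin m → Fin n₂ → ℝ} (h : I.ICOFeasible x y) :
    P.MasterFeasible σ x (fun s t l => I.excess x y s t (σ.c l)) (fun s => I.q s ⬝ᵥ y s) := by
  have hsub : ∀ s, y s ∈ I.SubFeas σ.c s x (fun t l => I.excess x y s t (σ.c l)) := by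
    refine fun s => ⟨(h.2.1 s).1, sub_le_iff_le_add'.2 (h.2.1 s).2, fun t l => ?_⟩
    have h1 : σ.c l ⬝ᵥ I.outcome s x (y s) - σ.c l ⬝ᵥ I.z t ≤ I.excess x y s t (σ.c l) :=
      le_max_left _ _
    rw [outcome, dotProduct_add] at h1
    linarith
  exact ⟨h.1, fun s => P.valid s x h.1 _ (h.2.1 s),
    fun e he => dualObj_le_of_mem_dualFeas (hσ.opt e he).2 (hsub e.scen),
    fun e he => dualObj_nonpos_of_mem_dualCone (hσ.feas e he).2 (hsub e.scen),
    fun t l => sub_nonneg.1 (h.2.2 t _ (hσ.c_mem l)), fun _ _ _ => le_max_right _ _⟩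

/-- The lower-bound half of the sandwich, holding at every stage since the master problem stays a
relaxation. -/
lemma Start.masterObj_le (P : I.Start) {σ : State n₁ n₂ m τ d r} (hσ : I.Invariant σ)
    {x : Fin n₁ → ℝ} {w : Fin m → Fin τ → Fin σ.L → ℝ} {θ : Fin m → ℝ}
    (hopt : P.MasterOptimal σ x w θ) {x' : Fin n₁ → ℝ} {y' : Fin m → Fin n₂ → ℝ}
    (h : I.ICOFeasible x' y') : I.masterObj x θ ≤ I.obj x' y' :=
  hopt.2 _ _ _ (P.masterFeasible_of_icoFeasible hσ h)

/-- Solutions of the subproblems satisfy the ICO constraints of the master problem. -/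
lemma sepObj_nonneg_of_subFeas {L : ℕ} {c : Fin L → Fin d → ℝ} {x : Fin n₁ → ℝ}
    {w : Fin m → Fin τ → Fin L → ℝ} {y : Fin m → Fin n₂ → ℝ}
    (hy : ∀ s, y s ∈ I.SubFeas c s x (w s)) {t : Fin τ} {l : Fin L}
    (hw : ∑ s, I.p s * w s t l ≤ I.benchExcess t (c l)) (hw0 : ∀ s, 0 ≤ w s t l) :
    0 ≤ I.sepObj x y t (c l) := by
  refine sub_nonneg.2 ((Finset.sum_le_sum fun s _ => ?_).trans hw)
  refine mul_le_mul_of_nonneg_left (max_le ?_ (hw0 s)) (I.p_nonneg s)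
  have := (hy s).2.2 t l
  rw [outcome, dotProduct_add]
  linarith

/-! ### Termination -/

/-- A step that does not change the scalarization vectors either adds a violated feasibility cut,
or a violated optimality cut, or changes nothing but the incumbent, which then attains the value
of the master problem. -/
lemma LoopBody.cases_of_eq {L : ℕ} {c : Fin L → Fin d → ℝ} {O F O' F' : Set (Cut m τ r)}
    {inc inc' : Option ((Fin n₁ → ℝ) × (Fin m → Fin n₂ → ℝ))} {x : Fin n₁ → ℝ}
    {w : Fin m → Fin τ → Fin L → ℝ} {θ : Fin m → ℝ}
    (h : I.LoopBody ⟨L, c, O, F, inc⟩ x w θ ⟨L, c, O', F', inc'⟩) (hx : x ∈ I.X) :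
    O ⊆ O' ∧ F ⊆ F' ∧
      ((∃ s g, IsExtremeRay (I.DualCone c s) g ∧ mkCut s g ∈ F' ∧ 0 < I.dualObj c s x (w s) g) ∨
      (∃ s, ∃ g ∈ Set.extremePoints ℝ (I.DualFeas c s), mkCut s g ∈ O' ∧
        θ s < I.dualObj c s x (w s) g) ∨
      (O' = O ∧ F' = F ∧ ∃ y, inc' = some (x, y) ∧ I.ICOFeasible x y ∧
        ∀ s, I.q s ⬝ᵥ y s ≤ θ s)) := by
  obtain ⟨y, ray, pt, O₁, F₁, hray, hpt, hF, hO, hcase⟩ := h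
  dsimp only at hray hpt hF hO hcase
  have hOO : O ⊆ O₁ := hO ▸ Set.subset_union_left
  have hFF : F ⊆ F₁ := hF ▸ Set.subset_union_left
  obtain ⟨⟨s, hs⟩, heq⟩ | ⟨hne, cst, hcst, ⟨hsep, heq⟩ | ⟨t, -, heq⟩⟩ := hcase
  · simp only [State.mk.injEq, heq_eq_eq, true_and] at heq
    obtain ⟨rfl, rfl, -⟩ := heq
    refine ⟨hOO, hFF, .inl ⟨s, ray s, (hray s hs).1, ?_, (hray s hs).2⟩⟩
    rw [hF]
    exact .inr ⟨s, hs, rfl⟩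
  · simp only [State.mk.injEq, heq_eq_eq, true_and] at heq
    obtain ⟨rfl, rfl, rfl⟩ := heq
    refine ⟨hOO, hFF, .inr ?_⟩
    by_cases hviol : ∃ s, θ s < I.q s ⬝ᵥ y s
    · obtain ⟨s, hs⟩ := hviol
      -- By strong duality the cut value at the master solution is at least the subproblem value,
      -- which exceeds `θ s`: the cut is violated.
      refine .inl ⟨s, pt s, (hpt s (hne s)).2.1, ?_,
        hs.trans_le ((hpt s (hne s)).1.le_dualObj (hpt s (hne s)).2.2)⟩
      rw [hO]
      exact .inr ⟨s, hne s, hs, rfl⟩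
    · push Not at hviol
      refine .inr ⟨?_, ?_, y, rfl,
        icoFeasible_of_sepVertexOptimal hx (fun s => (hpt s (hne s)).1.1) hcst hsep, hviol⟩
      · refine (hO ▸ Set.union_subset subset_rfl ?_ : O' ⊆ O).antisymm hOO
        rintro e ⟨s, -, hs, -⟩
        exact absurd hs (hviol s).not_gt
      · refine (hF ▸ Set.union_subset subset_rfl ?_ : F' ⊆ F).antisymm hFF
        rintro e ⟨s, hs, -⟩
        exact absurd hs (hne s).ne_empty
  · have := congrArg State.L heq
    simp at this

/-- The part of an iteration that leads from one memory to the next one. -/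
def Start.Step (P : I.Start) (ε : ℝ) (σ σ' : State n₁ n₂ m τ d r) : Prop :=
  ∃ x w θ, P.MasterOptimal σ x w θ ∧
    (∀ xh yh, σ.inc = some (xh, yh) → ¬ I.WithinTol ε (I.masterObj x θ) xh yh) ∧
    I.LoopBody σ x w θ σ'

lemma Start.Step.invariant {P : I.Start} {ε : ℝ} {σ σ' : State n₁ n₂ m τ d r}
    (h : P.Step ε σ σ') (hσ : I.Invariant σ) : I.Invariant σ' := by
  obtain ⟨x, w, θ, hopt, -, hbody⟩ := h
  exact hbody.invariant hopt.1.1 hσ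

lemma Start.Next.step_of_running {P : I.Start} {ε : ℝ} {σ σ' : State n₁ n₂ m τ d r}
    (h : P.Next ε (.running σ) (.running σ')) : P.Step ε σ σ' := by
  cases h with
  | step _ _ x w θ hopt htol hbody => exact ⟨x, w, θ, hopt, htol, hbody⟩

/-- With fixed scalarization vectors the algorithm cannot continue forever. -/
lemma Start.not_forall_step_of_fixed (P : I.Start) {ε : ℝ} (hε : 0 ≤ ε) {L : ℕ}
    {c : Fin L → Fin d → ℝ} {O F : ℕ → Set (Cut m τ r)}
    {inc : ℕ → Option ((Fin n₁ → ℝ) × (Fin m → Fin n₂ → ℝ))}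
    (hinv : ∀ j, I.Invariant ⟨L, c, O j, F j, inc j⟩)
    (hstep : ∀ j, P.Step ε ⟨L, c, O j, F j, inc j⟩ ⟨L, c, O (j + 1), F (j + 1), inc (j + 1)⟩) :
    False := by
  choose x w θ hopt htol hbody using hstep
  have hcase := fun j => (hbody j).cases_of_eq (hopt j).1.1
  choose R hRfin hR using fun s => I.exists_finite_dual_extremeRays c s
  have hOmono : Monotone O := monotone_nat_of_le_succ fun j => (hcase j).1
  have hFmono : Monotone F := monotone_nat_of_le_succ fun j => (hcase j).2.1
  obtain ⟨N₁, hN₁⟩ := exists_forall_ge_eq_of_monotone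
    (S := fun j => {p : Fin m × ((Fin r → ℝ) × (Fin τ → Fin L → ℝ)) |
      p.2 ∈ Set.extremePoints ℝ (I.DualFeas c p.1) ∧ mkCut p.1 p.2 ∈ O j})
    (Set.Finite.setOf_snd_mem fun s => (I.isPolyhedron_dualFeas c s).finite_extremePoints)
    (fun _ _ hij _ hp => ⟨hp.1, hOmono hij hp.2⟩) (fun _ _ hp => hp.1)
  -- An extreme ray may return with another length, so what is recorded is whether some positive
  -- multiple of a representative has given a cut.
  obtain ⟨N₂, hN₂⟩ := exists_forall_ge_eq_of_monotone
    (S := fun j => {p : Fin m × ((Fin r → ℝ) × (Fin τ → Fin L → ℝ)) |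
      p.2 ∈ R p.1 ∧ ∃ α : ℝ, 0 < α ∧ mkCut p.1 (α • p.2) ∈ F j})
    (Set.Finite.setOf_snd_mem hRfin)
    (fun _ _ hij _ hp => ⟨hp.1, hp.2.imp fun _ h => ⟨h.1, hFmono hij h.2⟩⟩) (fun _ _ hp => hp.1)
  set J := max N₁ N₂ with hJ
  have hJ₁ : N₁ ≤ J := le_max_left _ _
  have hJ₂ : N₂ ≤ J := le_max_right _ _
  obtain ⟨-, -, ⟨s, g, hg, hgF, hpos⟩ | ⟨s, g, hg, hgO, hlt⟩ | ⟨hO, hF, y, hy, hyf, hyθ⟩⟩ := hcase J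
  · obtain ⟨α, hα, e, he, rfl⟩ := hR s g hg
    -- A positive multiple of this ray already gave a cut before iteration `J`. The master solution
    -- satisfies that cut, and scaling does not change the sign.
    have hmem := ((hN₂ (J + 1) (by omega)).trans (hN₂ J hJ₂).symm).subset
      (show (s, e) ∈ _ from ⟨he, α, hα, hgF⟩)
    obtain ⟨-, α', hα', hcut⟩ := hmem
    have hle := (hopt J).1.2.2.2.1 _ hcut
    rw [cutRhs_mkCut, dualObj_smul] at hle
    rw [dualObj_smul] at hpos
    have h1 := pos_of_mul_pos_right hpos hα.le
    exact absurd hle (mul_pos hα' h1).not_ge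
  · have hmem := ((hN₁ (J + 1) (by omega)).trans (hN₁ J hJ₁).symm).subset
      (show (s, g) ∈ _ from ⟨hg, hgO⟩)
    have hle := (hopt J).1.2.2.1 _ hmem.2
    rw [cutRhs_mkCut] at hle
    exact absurd hle hlt.not_ge
  -- Here only the incumbent changed. The inequalities `h1`, `h2`, `h3` close a cycle, so the next
  -- master value equals the incumbent cost and its stopping test cannot fail.
  · refine htol (J + 1) (x J) y hy ?_
    have h1 : I.masterObj (x (J + 1)) (θ (J + 1)) ≤ I.obj (x J) y :=
      P.masterObj_le (hinv (J + 1)) (hopt (J + 1)) hyf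
    have h2 : I.obj (x J) y ≤ I.masterObj (x J) (θ J) := add_le_add le_rfl
      (Finset.sum_le_sum fun s _ => mul_le_mul_of_nonneg_left (hyθ s) (I.p_nonneg s))
    have h3 : I.masterObj (x J) (θ J) ≤ I.masterObj (x (J + 1)) (θ (J + 1)) := by
      refine (hopt J).2 _ (w (J + 1)) _ ?_
      have := (hopt (J + 1)).1
      rw [hO, hF] at this
      exact this
    have h4 : I.masterObj (x (J + 1)) (θ (J + 1)) = I.obj (x J) y := by linarith
    have h5 : 0 ≤ ε * |I.obj (x J) y| := mul_nonneg hε (abs_nonneg _)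
    rw [WithinTol, h4]
    exact ⟨by linarith, by linarith⟩

/-- A step keeps the scalarization vectors, and if it adds one, then the new one is a new element
of `vertexScal`. -/
lemma Start.Step.scal {P : I.Start} {ε : ℝ} {σ σ' : State n₁ n₂ m τ d r} (h : P.Step ε σ σ') :
    (∃ O F inc, σ' = ⟨σ.L, σ.c, O, F, inc⟩) ∨
      (Set.range σ.c ⊆ Set.range σ'.c ∧
        ∃ c ∈ I.vertexScal, c ∈ Set.range σ'.c ∧ c ∉ Set.range σ.c) := by
  obtain ⟨x, w, θ, hopt, -, y, ray, pt, O, F, hray, hpt, hF, hO, hcase⟩ := h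
  obtain ⟨-, rfl⟩ | ⟨hne, cst, hcst, ⟨-, rfl⟩ | ⟨t, hsep, rfl⟩⟩ := hcase
  · exact .inl ⟨_, _, _, rfl⟩
  · exact .inl ⟨_, _, _, rfl⟩
  · refine .inr ⟨?_, cst t, Set.mem_iUnion.2 ⟨t, (hcst t).2.2⟩, ⟨Fin.last _, ?_⟩, ?_⟩
    · rintro _ ⟨l, rfl⟩
      exact ⟨l.castSucc, Fin.snoc_castSucc (α := fun _ => Fin d → ℝ) _ _ _⟩
    · exact Fin.snoc_last (α := fun _ => Fin d → ℝ) _ _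
    -- A vector already present has a nonnegative separation value, by the master and subproblem
    -- constraints.
    · rintro ⟨l, hl⟩
      rw [← hl] at hsep
      exact hsep.not_ge (sepObj_nonneg_of_subFeas (fun s => (hpt s (hne s)).1.1)
        (hopt.1.2.2.2.2.1 t l) fun s => hopt.1.2.2.2.2.2 s t l)

/-- The algorithm cannot continue forever. -/
lemma Start.not_forall_step (P : I.Start) {ε : ℝ} (hε : 0 ≤ ε) {σ : ℕ → State n₁ n₂ m τ d r}
    (h0 : I.Invariant (σ 0)) (hstep : ∀ j, P.Step ε (σ j) (σ (j + 1))) : False := by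
  have hinv : ∀ j, I.Invariant (σ j) := fun j => by
    induction j with
    | zero => exact h0
    | succ j ih => exact (hstep j).invariant ih
  have hmono : Monotone fun j => Set.range (σ j).c := monotone_nat_of_le_succ fun j => by
    obtain ⟨O, F, inc, h⟩ | h := (hstep j).scal
    · rw [h]
    · exact h.1
  -- The intersection is needed because the initial vectors may lie in `C` but outside `vertexScal`.
  obtain ⟨N, hN⟩ := exists_forall_ge_eq_of_monotone
    (S := fun j => I.vertexScal ∩ Set.range (σ j).c) I.finite_vertexScal
    (fun _ _ hij => Set.inter_subset_inter_right _ (hmono hij)) (fun _ => Set.inter_subset_left)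
  have hfix : ∀ j, ∃ O F inc, σ (N + j) = ⟨(σ N).L, (σ N).c, O, F, inc⟩ := fun j => by
    induction j with
    | zero => exact ⟨_, _, _, rfl⟩
    | succ j ih =>
      obtain ⟨O, F, inc, h⟩ | ⟨-, c, hc, hc', hc''⟩ := (hstep (N + j)).scal
      · obtain ⟨O', F', inc', h'⟩ := ih
        rw [h'] at h
        exact ⟨O, F, inc, h⟩
      · have := ((hN (N + j + 1) (by omega)).trans (hN (N + j) (by omega)).symm).subset ⟨hc, hc'⟩
        exact absurd this.2 hc''
  choose O F inc hσ using hfix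
  refine P.not_forall_step_of_fixed hε (O := O) (F := F) (inc := inc)
    (fun j => hσ j ▸ hinv (N + j)) fun j => ?_
  have := hstep (N + j)
  rwa [hσ j, add_assoc, hσ (j + 1)] at this

/-! ### Runs -/

lemma Start.IsRun.invariant {P : I.Start} {ε : ℝ} {a : ℕ → Status n₁ n₂ m τ d r}
    (h : P.IsRun ε a) {j : ℕ} {σ : State n₁ n₂ m τ d r} (hj : a j = .running σ) :
    I.Invariant σ := by
  induction j generalizing σ with
  | zero =>
    rw [h.1] at hj
    obtain rfl := Status.running.inj hj
    exact P.invariant_init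
  | succ j ih =>
    have hnext := h.2 j
    rw [hj] at hnext
    cases hσ : a j with
    | running σ' =>
      rw [hσ] at hnext
      exact hnext.step_of_running.invariant (ih hσ)
    | infeasible => rw [hσ] at hnext; cases hnext
    | solved x y => rw [hσ] at hnext; cases hnext

/-- Every run stops: after some running iteration comes a final status. -/
lemma Start.IsRun.exists_last {P : I.Start} {ε : ℝ} (hε : 0 ≤ ε)
    {a : ℕ → Status n₁ n₂ m τ d r} (h : P.IsRun ε a) :
    ∃ N σ, a N = .running σ ∧ ∀ σ', a (N + 1) ≠ .running σ' := by
  by_contra! hcon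
  have hrun : ∀ j, ∃ σ, a j = .running σ := fun j => by
    induction j with
    | zero => exact ⟨_, h.1⟩
    | succ j ih =>
      obtain ⟨σ, hσ⟩ := ih
      exact hcon j σ hσ
  choose σ hσ using hrun
  refine P.not_forall_step hε (h.invariant (hσ 0)) fun j => ?_
  have := h.2 j
  rw [hσ j, hσ (j + 1)] at this
  exact this.step_of_running

/-- Every run stops with a proof of infeasibility or a solution that is optimal within the
tolerance. -/
lemma Start.IsRun.exists_result {P : I.Start} {ε : ℝ} (hε : 0 ≤ ε)
    {a : ℕ → Status n₁ n₂ m τ d r} (h : P.IsRun ε a) :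
    ∃ N, (a N = .infeasible ∧ ¬ ∃ x w y, I.DEFFeasible x w y) ∨
      ∃ x y, a N = .solved x y ∧ I.DEFFeasible x (fun s t c => I.excess x y s t c) y ∧
        ∀ x' w' y', I.DEFFeasible x' w' y' → I.obj x y ≤ I.obj x' y' + ε * |I.obj x y| := by
  obtain ⟨N, σ, hσ, hlast⟩ := h.exists_last hε
  have hinv := h.invariant hσ
  have hnext := h.2 N
  refine ⟨N + 1, ?_⟩
  rw [hσ] at hnext
  generalize a (N + 1) = st at hnext hlast
  cases hnext with
  | infeasible _ hno =>
    refine .inl ⟨rfl, ?_⟩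
    rintro ⟨x, w, y, hxy⟩
    exact hno _ _ _ (P.masterFeasible_of_icoFeasible hinv hxy.icoFeasible)
  | halt _ x w θ hopt xh yh hinc htol =>
    refine .inr ⟨xh, yh, rfl, (hinv.inc xh yh hinc).defFeasible, fun x' w' y' hxy => ?_⟩
    have := P.masterObj_le hinv hopt hxy.icoFeasible
    linarith [htol.1]
  | step _ σ' => exact absurd rfl (hlast σ')

lemma WithinTol.mono {ε ε' F : ℝ} (hle : ε ≤ ε') {x : Fin n₁ → ℝ} {y : Fin m → Fin n₂ → ℝ}
    (h : I.WithinTol ε F x y) : I.WithinTol ε' F x y := by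
  have := mul_le_mul_of_nonneg_right hle (abs_nonneg (I.obj x y))
  exact ⟨by linarith [h.1], by linarith [h.2]⟩

/-- At zero tolerance the test fails exactly when there is a nonzero gap, and a relative tolerance
too small to cover that gap fails too. The `+ 1` in the threshold guards against an objective value
of zero. -/
lemma exists_pos_not_withinTol {F : ℝ} {x : Fin n₁ → ℝ} {y : Fin m → Fin n₂ → ℝ}
    (h : ¬ I.WithinTol 0 F x y) : ∃ ε₀ > 0, ∀ ε < ε₀, ¬ I.WithinTol ε F x y := by
  have hne : I.obj x y - F ≠ 0 := fun heq => h (by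
    rw [sub_eq_zero] at heq
    simp [WithinTol, heq])
  have hpos : 0 < |I.obj x y| + 1 := by positivity
  refine ⟨|I.obj x y - F| / (|I.obj x y| + 1), by positivity, fun ε hε hT => ?_⟩
  rw [lt_div_iff₀ hpos] at hε
  have h1 : |I.obj x y - F| ≤ ε * |I.obj x y| := abs_le.2 ⟨by linarith [hT.2], by linarith [hT.1]⟩
  have h2 : 0 < |I.obj x y - F| := abs_pos.2 hne
  have h3 : ε < 0 := by linarith
  exact absurd (mul_nonpos_of_nonpos_of_nonneg h3.le (abs_nonneg (I.obj x y))) (by linarith)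

/-- A single iteration with zero tolerance is also an iteration for small tolerances. -/
lemma Start.Next.exists_pos {P : I.Start} {st st' : Status n₁ n₂ m τ d r} (h : P.Next 0 st st') :
    ∃ ε₀ > 0, ∀ ε, 0 ≤ ε → ε < ε₀ → P.Next ε st st' := by
  cases h with
  | infeasible σ hno => exact ⟨1, one_pos, fun ε _ _ => .infeasible σ hno⟩
  | halt σ x w θ hopt xh yh hinc htol =>
    exact ⟨1, one_pos, fun ε hε _ => .halt σ x w θ hopt xh yh hinc (htol.mono hε)⟩
  | step σ σ' x w θ hopt htol hbody =>
    cases hinc : σ.inc with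
    | none => exact ⟨1, one_pos, fun ε _ _ =>
        .step σ σ' x w θ hopt (fun xh yh h => by simp [hinc] at h) hbody⟩
    | some xy =>
      obtain ⟨xh, yh⟩ := xy
      obtain ⟨ε₀, hpos, hε₀⟩ := exists_pos_not_withinTol (htol xh yh hinc)
      refine ⟨ε₀, hpos, fun ε _ hε => .step σ σ' x w θ hopt (fun xh' yh' h => ?_) hbody⟩
      obtain ⟨rfl, rfl⟩ := Prod.mk.inj (Option.some.inj (hinc.symm.trans h))
      exact hε₀ ε hε
  | infeasible_stay => exact ⟨1, one_pos, fun ε _ _ => .infeasible_stay⟩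
  | solved_stay xh yh => exact ⟨1, one_pos, fun ε _ _ => .solved_stay xh yh⟩

/-- After the final status, a run stays as it is for every tolerance. -/
lemma Start.Next.of_not_running {P : I.Start} {ε ε' : ℝ} {st st' : Status n₁ n₂ m τ d r}
    (h : P.Next ε st st') (hst : ∀ σ, st ≠ .running σ) : P.Next ε' st st' ∧ st' = st := by
  cases h with
  | infeasible σ => exact absurd rfl (hst σ)
  | halt σ => exact absurd rfl (hst σ)
  | step σ => exact absurd rfl (hst σ)
  | infeasible_stay => exact ⟨.infeasible_stay, rfl⟩
  | solved_stay xh yh => exact ⟨.solved_stay xh yh, rfl⟩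

/-- The tolerance matters only up to the final status, which is reached after finitely many
iterations, so the minimum of their thresholds works. -/
lemma Start.IsRun.exists_pos {P : I.Start} {a : ℕ → Status n₁ n₂ m τ d r} (h : P.IsRun 0 a) :
    ∃ ε₀ > 0, ∀ ε, 0 ≤ ε → ε < ε₀ → P.IsRun ε a := by
  obtain ⟨N, σ, -, hlast⟩ := h.exists_last le_rfl
  have hfinal : ∀ j, N + 1 ≤ j → ∀ σ', a j ≠ .running σ' := fun j hj => by
    induction j, hj using Nat.le_induction with
    | base => exact hlast
    | succ j _ ih =>
      rw [((h.2 j).of_not_running (ε' := 0) ih).2]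
      exact ih
  choose δ hδpos hδ using fun j => (h.2 j).exists_pos
  have hne : (Finset.range (N + 1)).Nonempty := ⟨0, by simp⟩
  refine ⟨(Finset.range (N + 1)).inf' hne δ, (Finset.lt_inf'_iff hne).2 fun j _ => hδpos j,
    fun ε hε hlt => ⟨h.1, fun j => ?_⟩⟩
  rcases lt_or_ge j (N + 1) with hj | hj
  · exact hδ j ε hε ((Finset.lt_inf'_iff hne).1 hlt j (Finset.mem_range.2 hj))
  · exact ((h.2 j).of_not_running (hfinal j hj)).1

/-- An iteration can be carried out if its master problem is infeasible or has an optimal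
solution. -/
lemma Start.exists_next (P : I.Start) (ε : ℝ) (σ : State n₁ n₂ m τ d r)
    (h : (∃ x w θ, P.MasterFeasible σ x w θ) → ∃ x w θ, P.MasterOptimal σ x w θ) :
    ∃ st, P.Next ε (.running σ) st := by
  by_cases hfeas : ∃ x w θ, P.MasterFeasible σ x w θ
  swap
  · push Not at hfeas
    exact ⟨_, .infeasible σ hfeas⟩
  obtain ⟨x, w, θ, hopt⟩ := h hfeas
  by_cases htol : ∃ xh yh, σ.inc = some (xh, yh) ∧ I.WithinTol ε (I.masterObj x θ) xh yh
  · obtain ⟨xh, yh, hinc, htol⟩ := htol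
    exact ⟨_, .halt σ x w θ hopt xh yh hinc htol⟩
  push Not at htol
  -- The default `0`, here and for rays and dual points, fills scenarios in which the object is not
  -- required. The separation outcome is used only if all subproblems are feasible, when no default
  -- enters `y`.
  have hy : ∀ s, ∃ y, (I.SubFeas σ.c s x (w s)).Nonempty → I.SubOptimal σ.c s x (w s) y := by
    intro s
    by_cases hne : (I.SubFeas σ.c s x (w s)).Nonempty
    · exact (exists_subOptimal hopt.1.1 hne).imp fun _ h _ => h
    · exact ⟨0, fun h => absurd h hne⟩
  choose y hy using hy
  have hray : ∀ s, ∃ g, I.SubFeas σ.c s x (w s) = ∅ →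
      IsExtremeRay (I.DualCone σ.c s) g ∧ 0 < I.dualObj σ.c s x (w s) g := by
    intro s
    by_cases he : I.SubFeas σ.c s x (w s) = ∅
    · exact (exists_extremeRay_of_subFeas_eq_empty he).imp fun _ h _ => h
    · exact ⟨0, fun h => absurd h he⟩
  choose ray hray using hray
  have hpt : ∀ s, ∃ g, (I.SubFeas σ.c s x (w s)).Nonempty →
      g ∈ Set.extremePoints ℝ (I.DualFeas σ.c s) ∧
      ∀ g' ∈ I.DualFeas σ.c s, I.dualObj σ.c s x (w s) g' ≤ I.dualObj σ.c s x (w s) g := by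
    intro s
    by_cases hne : (I.SubFeas σ.c s x (w s)).Nonempty
    · exact (exists_dual_optimal_vertex (hy s hne)).imp fun _ h _ => h
    · exact ⟨0, fun h => absurd h hne⟩
  choose pt hpt using hpt
  choose cst hcst using fun t => I.exists_sepVertexOptimal t x y
  have hbody : ∃ σ', I.LoopBody σ x w θ σ' := by
    by_cases he : ∃ s, I.SubFeas σ.c s x (w s) = ∅
    · exact ⟨_, y, ray, pt, _, _, hray, fun s hs => ⟨hy s hs, hpt s hs⟩, rfl, rfl, .inl ⟨he, rfl⟩⟩
    · have hne : ∀ s, (I.SubFeas σ.c s x (w s)).Nonempty := fun s =>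
        Set.nonempty_iff_ne_empty.2 fun hs => he ⟨s, hs⟩
      by_cases hsep : ∀ t, 0 ≤ I.sepObj x y t (cst t)
      · exact ⟨_, y, ray, pt, _, _, hray, fun s hs => ⟨hy s hs, hpt s hs⟩, rfl, rfl,
          .inr ⟨hne, cst, hcst, .inl ⟨hsep, rfl⟩⟩⟩
      · push Not at hsep
        obtain ⟨t, ht⟩ := hsep
        exact ⟨_, y, ray, pt, _, _, hray, fun s hs => ⟨hy s hs, hpt s hs⟩, rfl, rfl,
          .inr ⟨hne, cst, hcst, .inr ⟨t, ht, rfl⟩⟩⟩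
  obtain ⟨σ', hbody⟩ := hbody
  exact ⟨_, .step σ σ' x w θ hopt htol hbody⟩

end TwoStageICO

theorem mainTheorem3 {n₁ n₂ m τ d r k : ℕ} (I : TwoStageICO n₁ n₂ m τ d r k) (P : I.Start) :
    -- the deterministic equivalent uses finitely many scalarization vectors
    I.vertexScal.Finite ∧
    -- with zero tolerance every run stops with an optimal solution or a proof of infeasibility,
    -- and it is also a run for every sufficiently small positive tolerance
    (∀ a, P.IsRun 0 a →
      (∃ N, (a N = .infeasible ∧ ¬ ∃ x w y, I.DEFFeasible x w y) ∨
        ∃ x y, a N = .solved x y ∧ I.DEFOptimal x (fun s t c => I.excess x y s t c) y) ∧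
      ∃ ε₀ > 0, ∀ ε, 0 ≤ ε → ε < ε₀ → P.IsRun ε a) ∧
    -- with any tolerance every run stops with a proof of infeasibility or a feasible solution
    -- that is optimal within the tolerance
    (∀ ε, 0 ≤ ε → ∀ a, P.IsRun ε a →
      ∃ N, (a N = .infeasible ∧ ¬ ∃ x w y, I.DEFFeasible x w y) ∨
        ∃ x y, a N = .solved x y ∧ I.DEFFeasible x (fun s t c => I.excess x y s t c) y ∧
          ∀ x' w' y', I.DEFFeasible x' w' y' →
            I.obj x y ≤ I.obj x' y' + ε * |I.obj x y|) ∧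
    -- every iteration can be carried out, provided that its master problem is infeasible or
    -- has an optimal solution
    (∀ ε, 0 ≤ ε → ∀ σ, P.Reachable ε σ →
      ((∃ x w θ, P.MasterFeasible σ x w θ) → ∃ x w θ, P.MasterOptimal σ x w θ) →
      ∃ st, P.Next ε (.running σ) st) := by
  refine ⟨I.finite_vertexScal, fun a ha => ⟨?_, ha.exists_pos⟩, fun ε hε a ha =>
    ha.exists_result hε, fun ε _ σ _ h => P.exists_next ε σ h⟩
  obtain ⟨N, h | ⟨x, y, hN, hfeas, hle⟩⟩ := ha.exists_result le_rfl
  · exact ⟨N, .inl h⟩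
  · refine ⟨N, .inr ⟨x, y, hN, hfeas, fun x' w' y' h' => ?_⟩⟩
    -- At zero tolerance the error term vanishes, which leaves exact optimality.
    simpa using hle x' w' y' h'
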